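/- Let $\Bbbk$ be a commutative ring with unit. Let $\mathbf{FI}$, $\mathbf{\Sigma}$ and $\mathbf{\Omega}$ be the categories of finite sets with, respectively, injections, bijections and surjections as morphisms, and write $\mathbf{n}=\{1,\dots,n\}$. An $\mathbf{FI}^{\mathrm{op}}$-module (resp. $\mathbf{\Sigma}^{\mathrm{op}}$-module) is a functor from $\mathbf{FI}^{\mathrm{op}}$ (resp. $\mathbf{\Sigma}^{\mathrm{op}}$) to $\Bbbk$-modules. For an $\mathbf{FI}^{\mathrm{op}}$-module $F$, let $H^0_{\mathbf{FI}^{\mathrm{op}}}(F)$ be the $\mathbf{\Sigma}^{\mathrm{op}}$-module of primitives: $H^0_{\mathbf{FI}^{\mathrm{op}}}(F)(b)$ is the equalizer of the two maps $\eta,\psi: F(b)\rightrightarrows\bigoplus_{b'\subseteq b}F(b')$, where $\eta$ is the inclusion of the summand $b'=b$ and $\psi$ has components the restrictions $F(b)\to F(b')$ along the inclusions $b'\subseteq b$. Let $H^n_{\mathbf{FI}^{\mathrm{op}}}$ be the $n$-th right derived functor of $H^0_{\mathbf{FI}^{\mathrm{op}}}$. For $a\in\mathbb{N}$, let $\Bbbk\hom_{\mathbf{\Omega}}(-,\mathbf{a})$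 be the $\mathbf{FI}^{\mathrm{op}}$-module sending a finite set $b$ to the free $\Bbbk$-module on the set of surjections $b\twoheadrightarrow\mathbf{a}$, where an injection $i:b'\hookrightarrow b$ sends a generator $[f]$ to $[f\circ i]$ if $f\circ i$ is surjective, and to $0$ otherwise. Let $\mathrm{Rk}:\mathbb{N}\times\mathbb{N}\to\mathbb{N}$ be the function determined by: $\mathrm{Rk}(0,0)=1$ and $\mathrm{Rk}(b,0)=0$ for $b>0$; $\mathrm{Rk}(b,a)=0$ for $b<a$; $\mathrm{Rk}(a,a)=a!$; $\mathrm{Rk}(b,1)=0$ for $b>1$; $\mathrm{Rk}(a+1,a)=(a-2)\frac{(a+1)!}{2}+1$ for $a>1$; and $\mathrm{Rk}(b,a)=a\,\mathrm{Rk}(b-1,a-1)+(a-1)\,\mathrm{Rk}(b-1,a)$ for $b-1>a>1$. Then for all $a,b,n\in\mathbb{N}$ there is an isomorphism of $\Bbbk$-modules $$H^n_{\mathbf{FI}^{\mathrm{op}}}\bigl(\Bbbk\hom_{\mathbf{\Omega}}(-,\mathbf{a})\bigr)(\mathbf{b})\cong\begin{cases}\Bbbk^{\oplus\mathrm{Rk}(b,a)}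 & \text{if } b\ge a>0 \text{ and } n=0,\\ \Bbbk & \text{if } (b>a\ge 0 \text{ and } n=b-a) \text{ or } a=b=n=0,\\ 0&\text{otherwise.}\end{cases}$$ -/

import Mathlib

open CategoryTheory CategoryTheory.Limits Opposite

universe u

noncomputable section

namespace FIop

/-! ## Finite sets with injections, bijections, surjections -/

/-- The category of finite sets and injections. -/
structure FI where
  carrier : Type
  [finite : Finite carrier]

/-- The category of finite sets and bijections. -/
structure FB where
  carrier : Type
  [finite : Finite carrier]

/-- The category of finite sets and surjections. -/
structure Omega where
  carrier : Type
  [finite : Finite carrier]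

attribute [instance] FI.finite FB.finite Omega.finite

instance : Category FI where
  Hom X Y := X.carrier ↪ Y.carrier
  id X := Function.Embedding.refl X.carrier
  comp f g := f.trans g

instance : Category FB where
  Hom X Y := X.carrier ≃ Y.carrier
  id X := Equiv.refl X.carrier
  comp f g := f.trans g

instance : Category Omega where
  Hom X Y := {f : X.carrier → Y.carrier // Function.Surjective f}
  id X := ⟨id, Function.surjective_id⟩
  comp f g := ⟨g.1 ∘ f.1, g.2.comp f.2⟩

/-- The morphism of `FI` given by an injection. -/
def FI.ofEmb {X Y : FI} (f : X.carrier ↪ Y.carrier) : X ⟶ Y := f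

/-- The morphism of `FB` given by a bijection. -/
def FB.ofEquiv {X Y : FB} (f : X.carrier ≃ Y.carrier) : X ⟶ Y := f

/-- The inclusion of finite sets and bijections into finite sets and injections. -/
def inclFB : FB ⥤ FI where
  obj X := ⟨X.carrier⟩
  map {X Y} f := FI.ofEmb (Equiv.toEmbedding (show X.carrier ≃ Y.carrier from f))

/-- The category of `FI^op`-modules over `k`. -/
abbrev FIopMod (k : Type u) [CommRing k] := FIᵒᵖ ⥤ ModuleCat.{u} k

/-- The category of `Σ^op`-modules over `k` (`Σ` = finite sets and bijections). -/
abbrev FBopMod (k : Type u) [CommRing k] := FBᵒᵖ ⥤ ModuleCat.{u} k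

variable {k : Type u} [CommRing k]

/-- The restriction of an `FI^op`-module to bijections. -/
abbrev restrictFB (F : FIopMod k) : FBopMod k := inclFB.op ⋙ F

/-! ## Primitives -/

/-- A subset of a finite set, as a finite set. -/
abbrev FB.sub (b : FB) (s : Set b.carrier) : FB := ⟨s⟩

/-- The inclusion of a subset, as a morphism of `FI`. -/
def FB.subIncl (b : FB) (s : Set b.carrier) : inclFB.obj (b.sub s) ⟶ inclFB.obj b :=
  FI.ofEmb (Function.Embedding.subtype (· ∈ s))

/-- The module `(⊥ G)(b) = ⨁_{b' ⊆ b} G(b')`; the sum is finite, hence is a product. -/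
abbrev perpObj (G : FBopMod k) (b : FB) : Type u :=
  ∀ s : Set b.carrier, G.obj (op (b.sub s))

open Classical in
/-- The coaugmentation `η : G(b) → ⨁_{b' ⊆ b} G(b')`, the inclusion of the summand `b' = b`. -/
def eta (G : FBopMod k) (b : FB) : G.obj (op b) →ₗ[k] perpObj G b :=
  LinearMap.pi fun s =>
    if h : s = Set.univ then
      (G.map (FB.ofEquiv (X := b.sub s) (Y := b)
        ((Equiv.setCongr h).trans (Equiv.Set.univ b.carrier))).op).hom
    else 0

/-- The comodule structure `ψ : F(b) → ⨁_{b' ⊆ b} F(b')` of an `FI^op`-module, with components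
the restrictions along the inclusions `b' ⊆ b`. -/
def psi (F : FIopMod k) (b : FB) :
    (restrictFB F).obj (op b) →ₗ[k] perpObj (restrictFB F) b :=
  LinearMap.pi fun s => (F.map (b.subIncl s).op).hom

/-- The primitives of `F` at `b`: the equalizer of `η` and `ψ`. -/
def primitives (F : FIopMod k) (b : FB) : Submodule k ((restrictFB F).obj (op b)) :=
  LinearMap.eqLocus (eta (restrictFB F) b) (psi F b)

/-- The primitives are the elements killed by restriction to proper subsets. -/
lemma mem_primitives_iff (F : FIopMod k) (b : FB) (x : (restrictFB F).obj (op b)) :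
    x ∈ primitives F b ↔
      ∀ s : Set b.carrier, s ≠ Set.univ → (F.map (b.subIncl s).op).hom x = 0 := by
  rw [primitives, LinearMap.mem_eqLocus, funext_iff]
  refine forall_congr' fun s => ?_
  by_cases h : s = Set.univ
  · subst h
    simp only [ne_eq, not_true_eq_false, false_imp_iff, iff_true]
    simp only [eta, psi, LinearMap.pi_apply, dif_pos]
    rfl
  · simp only [eta, psi, LinearMap.pi_apply, ne_eq, h, not_false_eq_true, true_imp_iff]
    exact eq_comm

/-- The primitives are stable under bijections. -/
lemma map_mem_primitives (F : FIopMod k) {b c : FB} (g : c ⟶ b)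
    (x : (restrictFB F).obj (op b)) (hx : x ∈ primitives F b) :
    ((restrictFB F).map g.op).hom x ∈ primitives F c := by
  rw [mem_primitives_iff] at hx ⊢
  intro s hs
  let e : c.carrier ≃ b.carrier := g
  have ht : e '' s ≠ Set.univ := by
    intro h
    apply hs
    rw [← Set.preimage_image_eq s e.injective, h, Set.preimage_univ]
  let q : inclFB.obj (c.sub s) ⟶ inclFB.obj (b.sub (e '' s)) :=
    FI.ofEmb (e.image s).toEmbedding
  have hq : c.subIncl s ≫ inclFB.map g = q ≫ b.subIncl (e '' s) := rfl
  have h1 : (F.map (inclFB.map g).op ≫ F.map (c.subIncl s).op) =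
      F.map (b.subIncl (e '' s)).op ≫ F.map q.op := by
    rw [← F.map_comp, ← F.map_comp, ← op_comp, ← op_comp, hq]
  have h2 := congrArg (fun φ => φ.hom x) h1
  simp only [ModuleCat.hom_comp, LinearMap.comp_apply] at h2
  refine h2.trans ?_
  rw [hx _ ht, map_zero]

/-- Morphisms of `FI^op`-modules preserve primitives. -/
lemma app_mem_primitives {F G : FIopMod k} (φ : F ⟶ G) (b : FB)
    (x : (restrictFB F).obj (op b)) (hx : x ∈ primitives F b) :
    (φ.app (op (inclFB.obj b))).hom x ∈ primitives G b := by
  rw [mem_primitives_iff] at hx ⊢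
  intro s hs
  have h2 := congrArg (fun ψ => ψ.hom x) (φ.naturality (b.subIncl s).op)
  simp only [ModuleCat.hom_comp, LinearMap.comp_apply] at h2
  refine h2.symm.trans ?_
  rw [hx s hs, map_zero]

/-- The functor `H^0_{FI^op}` of primitives, from `FI^op`-modules to `Σ^op`-modules. -/
def H0 (k : Type u) [CommRing k] : FIopMod k ⥤ FBopMod k where
  obj F :=
    { obj := fun b => ModuleCat.of k (primitives F b.unop)
      map := fun {b c} g => ModuleCat.ofHom
        (((restrictFB F).map g).hom.restrict (fun x hx => map_mem_primitives F g.unop x hx))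
      map_id := fun b => by
        ext x
        exact congrArg (fun φ => φ.hom x.1) ((restrictFB F).map_id b)
      map_comp := fun {b c d} g h => by
        ext x
        exact congrArg (fun φ => φ.hom x.1) ((restrictFB F).map_comp g h) }
  map {F G} φ :=
    { app := fun b => ModuleCat.ofHom
        ((φ.app (op (inclFB.obj b.unop))).hom.restrict
          (fun x hx => app_mem_primitives φ b.unop x hx))
      naturality := fun {b c} g => by
        ext x
        exact congrArg (fun ψ => ψ.hom x.1) (φ.naturality (inclFB.op.map g)) }
  map_id F := rfl
  map_comp φ ψ := rfl

instance : (H0 k).Additive where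
  map_add := rfl

/-! ## Enough injectives, and the derived functors of primitives -/

/-- An object of `FI` is isomorphic to some `{1, …, n}`. -/
lemma FI.exists_iso (X : FI) : ∃ n : ℕ, Nonempty (X ≅ (⟨Fin n⟩ : FI)) := by
  obtain ⟨n, ⟨e⟩⟩ := Finite.exists_equiv_fin X.carrier
  exact ⟨n, ⟨{
    hom := FI.ofEmb e.toEmbedding
    inv := FI.ofEmb e.symm.toEmbedding
    hom_inv_id := Function.Embedding.ext fun x => e.symm_apply_apply x
    inv_hom_id := Function.Embedding.ext fun x => e.apply_symm_apply x }⟩⟩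

instance : EnoughInjectives (FIopMod k) where
  presentation F := by
    let pt : ℕ → FIᵒᵖ := fun n => op ⟨Fin n⟩
    let R : ∀ n : ℕ, ModuleCat.{u} k ⥤ FIopMod k := fun n => evaluationRightAdjoint _ (pt n)
    let adj : ∀ n, (evaluation FIᵒᵖ (ModuleCat.{u} k)).obj (pt n) ⊣ R n :=
      fun n => evaluationAdjunctionLeft _ (pt n)
    let J : ℕ → FIopMod k := fun n => (R n).obj (Injective.under (F.obj (pt n)))
    have : ∀ n, Injective (J n) := fun n => Injective.injective_of_adjoint (adj n) _
    let f : F ⟶ ∏ᶜ J := Pi.lift fun n => (adj n).homEquiv _ _ (Injective.ι (F.obj (pt n)))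
    refine ⟨⟨∏ᶜ J, inferInstance, f, ⟨?_⟩⟩⟩
    intro G α β h
    have hn : ∀ n, α.app (pt n) = β.app (pt n) := by
      intro n
      have h1 := congrArg (fun t => t ≫ Pi.π J n) h
      simp only [f, Category.assoc, Pi.lift_π] at h1
      rw [← (adj n).homEquiv_naturality_left, ← (adj n).homEquiv_naturality_left] at h1
      have h2 := ((adj n).homEquiv _ _).injective h1
      exact (cancel_mono (Injective.ι (F.obj (pt n)))).1 h2
    ext1
    ext1 X
    obtain ⟨n, ⟨e⟩⟩ := FI.exists_iso X.unop
    have h3 : G.map e.inv.op ≫ α.app (pt n) = G.map e.inv.op ≫ β.app (pt n) := by rw [hn]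
    have h4 : α.app X ≫ F.map e.inv.op = β.app X ≫ F.map e.inv.op := by
      rw [← α.naturality, ← β.naturality]
      exact h3
    exact (cancel_mono (F.map e.inv.op)).1 h4

/-- `FI^op`-cohomology `H^n_{FI^op}`: the `n`-th right derived functor of the functor of
primitives. -/
def cohomology (k : Type u) [CommRing k] (n : ℕ) : FIopMod k ⥤ FBopMod k :=
  (H0 k).rightDerived n

/-! ## The `FI^op`-module `k Hom_Ω(-, a)` -/

open Classical in
/-- The restriction of a surjection `f : b → a` along an injection `i : b' → b`: the basis element
`[f ∘ i]` if this is surjective, zero otherwise. -/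
def restrictSurj (k : Type u) [CommRing k] (a : Omega) {b b' : FI} (i : b' ⟶ b)
    (f : (⟨b.carrier⟩ : Omega) ⟶ a) : ((⟨b'.carrier⟩ : Omega) ⟶ a) →₀ k :=
  let i' : b'.carrier ↪ b.carrier := i
  if h : Function.Surjective (f.1 ∘ i') then Finsupp.single ⟨f.1 ∘ i', h⟩ 1 else 0

/-- The `FI^op`-module `k Hom_Ω(-, a)`. -/
def kHom (k : Type u) [CommRing k] (a : Omega) : FIopMod k where
  obj b := ModuleCat.of k (((⟨b.unop.carrier⟩ : Omega) ⟶ a) →₀ k)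
  map {b b'} i := ModuleCat.ofHom
    (Finsupp.linearCombination k (restrictSurj k a i.unop))
  map_id b := by
    ext1
    refine Finsupp.lhom_ext' fun f => LinearMap.ext_ring ?_
    have hf : Function.Surjective f.1 := f.2
    simp only [ModuleCat.hom_ofHom, LinearMap.comp_apply, Finsupp.lsingle_apply,
      Finsupp.linearCombination_single, one_smul]
    exact dif_pos hf
  map_comp {b c d} i j := by
    ext1
    refine Finsupp.lhom_ext' fun f => LinearMap.ext_ring ?_
    simp only [ModuleCat.hom_ofHom, ModuleCat.hom_comp, LinearMap.comp_apply,
      Finsupp.lsingle_apply, Finsupp.linearCombination_single, one_smul]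
    let i' : c.unop.carrier ↪ b.unop.carrier := i.unop
    let j' : d.unop.carrier ↪ c.unop.carrier := j.unop
    by_cases h : Function.Surjective (f.1 ∘ i')
    · rw [show restrictSurj k a i.unop f = Finsupp.single ⟨f.1 ∘ i', h⟩ 1 from dif_pos h]
      rw [Finsupp.linearCombination_single, one_smul]
      rfl
    · have h' : ¬ Function.Surjective (f.1 ∘ i' ∘ j') := fun hs =>
        h (Function.Surjective.of_comp (f := f.1 ∘ i') (g := j') hs)
      rw [show restrictSurj k a i.unop f = 0 from dif_neg h, map_zero]
      exact dif_neg h'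

/-! ## The ranks -/

/-- The numbers `Rk(b, a)`, for `b, a : ℕ`. -/
def Rk : ℕ → ℕ → ℕ
  | 0, 0 => 1
  | 0, _ + 1 => 0
  | _ + 1, 0 => 0
  | b + 1, a + 1 =>
    if b < a then 0
    else if b = a then (a + 1).factorial
    else if a = 0 then 0
    else if b = a + 1 then (a - 1) * (a + 2).factorial / 2 + 1
    else (a + 1) * Rk b a + a * Rk b (a + 1)

end FIop

end

/-! The primitives at `c` are corepresented by the module `bijMod k c` with basis the bijections
onto `c`, so the cohomology at `c` is `Ext^n(bijMod k c, -)` (`cohomologyEquiv`). It is computed by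
removing the points of `c` one at a time.

Let `diff F` send `c` to the kernel of `F(c ⊔ {*}) → F(c)`. Primitives of `F` at `c ⊔ {*}` are
exactly primitives of `diff F` at `c`. The functor `diff` preserves injectives, because its left
adjoint `codiff` preserves monomorphisms, and it preserves short exact sequences whose first term
has surjective restrictions along `c ⊆ c ⊔ {*}`. By dimension shifting, `H^n(F)(c ⊔ {*}) ≅ H^n(diff
F)(c)` for every `F` with surjective restrictions (`nonempty_H_opt_equiv`). At the empty set the
primitives are all of `F(∅)`, so there is no higher cohomology.

The induction needs a larger family than the surjections: `hitMod k P R`, spanned by the maps with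
`P ⊆ image ⊆ R`, the surjections being the case `P = R`. Two exact sequences carry the argument.
Sorting maps by whether they take the value `j ∉ R` gives `0 → hit(P, R) → hit(P, R ∪ j) → hit(P ∪
j, R ∪ j) → 0` (`hitShortComplex_shortExact`). Sorting by the value at the added point gives, for `q
∈ P ⊆ R`, `0 → hit(P \ q, R \ q) → diff hit(P, R) → ∏_{j ∈ R \ q} hit(P \ j, R) → 0`
(`hitDiffShortComplex_shortExact`); for `q ∈ R \ P` the second map is already an isomorphism.

If `P` is strictly contained in `R`, the isomorphism and induction on the number of points show that
`hit(P, R)` has no higher cohomology, and that its `H^0` is free of a rank given by a recursion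
(`H_hitMod_of_ssubset`). Hence in the first sequence with `R = P` the middle term is acyclic, and
each added value shifts the degree by one; this reduces the positive degrees for surjections to the
module `hit(∅, ∅)` concentrated at the empty set, which contributes one copy of `k` in degree `b`
(`H_hitMod_empty`, `H_hitMod_self_succ`). In degree zero the second sequence stays exact on `H^0`:
the next map is a surjection between free modules of equal rank on `H^1`, hence injective. This
gives the recursion `surjRank` (`H_zero_hitMod_self`), and arithmetic identifies it with `Rk`
(`surjRank_eq_Rk`). -/

noncomputable section

namespace FIop

variable {k : Type u} [CommRing k]

/-! ## Elementwise tools for `FI^op`-modules -/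

/-- The restriction map of an `FI^op`-module along an injection. -/
abbrev res (F : FIopMod k) {c d : FI} (i : d ⟶ c) : F.obj (op c) →ₗ[k] F.obj (op d) :=
  (F.map i.op).hom

lemma res_id (F : FIopMod k) (c : FI) (x : F.obj (op c)) : res F (𝟙 c) x = x :=
  congrArg (fun φ => φ.hom x) (F.map_id (op c))

lemma res_comp (F : FIopMod k) {c d e : FI} (i : d ⟶ c) (j : e ⟶ d) (x : F.obj (op c)) :
    res F (j ≫ i) x = res F j (res F i x) :=
  congrArg (fun φ => φ.hom x) (F.map_comp i.op j.op)

/-- The component of a morphism of `FI^op`-modules. -/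
abbrev comp {F G : FIopMod k} (φ : F ⟶ G) (c : FI) : F.obj (op c) →ₗ[k] G.obj (op c) :=
  (φ.app (op c)).hom

lemma comp_res {F G : FIopMod k} (φ : F ⟶ G) {c d : FI} (i : d ⟶ c) (x : F.obj (op c)) :
    comp φ d (res F i x) = res G i (comp φ c x) :=
  congrArg (fun ψ => ψ.hom x) (φ.naturality i.op)

/-- A morphism of `FI^op`-modules from its components. -/
def mkHom {F G : FIopMod k} (φ : ∀ c : FI, F.obj (op c) →ₗ[k] G.obj (op c))
    (h : ∀ {c d : FI} (i : d ⟶ c) (x : F.obj (op c)), φ d (res F i x) = res G i (φ c x)) :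
    F ⟶ G where
  app c := ModuleCat.ofHom (φ c.unop)
  naturality c d i := by
    ext x
    exact h i.unop x

lemma hom_ext {F G : FIopMod k} {φ ψ : F ⟶ G} (h : ∀ c x, comp φ c x = comp ψ c x) : φ = ψ := by
  ext c x
  exact h c.unop x

lemma mono_iff {F G : FIopMod k} (φ : F ⟶ G) :
    Mono φ ↔ ∀ c, Function.Injective (comp φ c) := by
  rw [NatTrans.mono_iff_mono_app]
  exact ⟨fun h c => (ModuleCat.mono_iff_injective _).1 (h (op c)),
    fun h c => (ModuleCat.mono_iff_injective _).2 (h c.unop)⟩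

lemma epi_iff {F G : FIopMod k} (φ : F ⟶ G) :
    Epi φ ↔ ∀ c, Function.Surjective (comp φ c) := by
  rw [NatTrans.epi_iff_epi_app]
  exact ⟨fun h c => (ModuleCat.epi_iff_surjective _).1 (h (op c)),
    fun h c => (ModuleCat.epi_iff_surjective _).2 (h c.unop)⟩

lemma exact_of_exact_app {S : ShortComplex (FIopMod k)}
    (h : ∀ c (x : S.X₂.obj (op c)), comp S.g c x = 0 → ∃ y, comp S.f c y = x) : S.Exact := by
  rw [S.exact_iff_isZero_homology, Functor.isZero_iff]
  intro c
  have h1 : (S.map ((evaluation _ _).obj c)).Exact :=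
    (ShortComplex.moduleCat_exact_iff _).2 (fun x hx => h c.unop x hx)
  exact ((ShortComplex.exact_iff_isZero_homology _).1 h1).of_iso
    (S.mapHomologyIso ((evaluation _ _).obj c)).symm

lemma exact_app {S : ShortComplex (FIopMod k)} (hS : S.Exact) (c : FI) (x : S.X₂.obj (op c))
    (hx : comp S.g c x = 0) : ∃ y, comp S.f c y = x :=
  (ShortComplex.moduleCat_exact_iff _).1 (hS.map ((evaluation _ _).obj (op c))) x hx

/-- A short exact sequence of `FI^op`-modules, from pointwise data. -/
lemma shortExact_of_app {S : ShortComplex (FIopMod k)}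
    (hf : ∀ c, Function.Injective (comp S.f c))
    (hg : ∀ c, Function.Surjective (comp S.g c))
    (h : ∀ c (x : S.X₂.obj (op c)), comp S.g c x = 0 → ∃ y, comp S.f c y = x) :
    S.ShortExact where
  exact := exact_of_exact_app h
  mono_f := (mono_iff _).2 hf
  epi_g := (epi_iff _).2 hg

/-! ## Free modules on partial presheaves -/

/-- A presheaf on `FI` with values in sets and partial maps. -/
structure PartialPresheaf where
  obj : FI → Type
  res : ∀ {c d : FI}, (d ⟶ c) → obj c → Option (obj d)
  res_id : ∀ c x, res (𝟙 c) x = some x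
  res_comp : ∀ {c d e : FI} (i : d ⟶ c) (j : e ⟶ d) (x : obj c),
    res (j ≫ i) x = (res i x).bind (res j)

/-- The generator given by an element of `Option X`; zero if there is none. -/
def gen (k : Type u) [CommRing k] {X : Type} (o : Option X) : X →₀ k :=
  o.elim 0 fun x => Finsupp.single x 1

@[simp] lemma gen_some {X : Type} (x : X) : gen k (some x) = Finsupp.single x 1 := rfl

@[simp] lemma gen_none {X : Type} : gen k (none : Option X) = 0 := rfl

/-- The linear map given by a partial map of bases. -/
def pmap (k : Type u) [CommRing k] {X Y : Type} (g : X → Option Y) : (X →₀ k) →ₗ[k] (Y →₀ k) :=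
  Finsupp.linearCombination k fun x => gen k (g x)

@[simp] lemma pmap_single {X Y : Type} (g : X → Option Y) (x : X) :
    pmap k g (Finsupp.single x 1) = gen k (g x) := by
  simp [pmap]

lemma pmap_gen {X Y : Type} (g : X → Option Y) (o : Option X) :
    pmap k g (gen k o) = gen k (o.bind g) := by
  cases o <;> simp

lemma linearMap_ext {X : Type} {M : Type*} [AddCommGroup M] [Module k M] {f g : (X →₀ k) →ₗ[k] M}
    (h : ∀ x, f (Finsupp.single x 1) = g (Finsupp.single x 1)) : f = g :=
  Finsupp.lhom_ext' fun x => LinearMap.ext_ring (h x)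

/-- The free `FI^op`-module on a partial presheaf. -/
def freeMod (k : Type u) [CommRing k] (X : PartialPresheaf) : FIopMod k where
  obj c := ModuleCat.of k (X.obj c.unop →₀ k)
  map i := ModuleCat.ofHom (pmap k (X.res i.unop))
  map_id c := by
    ext1
    refine linearMap_ext fun x => ?_
    simp [X.res_id]
  map_comp {c d e} i j := by
    ext1
    refine linearMap_ext fun x => ?_
    simp [X.res_comp, pmap_gen]

/-- The generators of a free module. -/
def basisElt (k : Type u) [CommRing k] {X : PartialPresheaf} {c : FI} (x : X.obj c) :
    (freeMod k X).obj (op c) :=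
  (Finsupp.single x 1 : X.obj c →₀ k)

lemma freeMod_res_basisElt {X : PartialPresheaf} {c d : FI} (i : d ⟶ c) (x : X.obj c) :
    res (freeMod k X) i (basisElt k x) = (X.res i x).elim 0 (basisElt k) :=
  (pmap_single (k := k) (X.res i) x).trans (by cases X.res i x <;> rfl)

lemma freeMod_linearMap_ext {X : PartialPresheaf} {c : FI} {M : Type*} [AddCommGroup M]
    [Module k M] {f g : (freeMod k X).obj (op c) →ₗ[k] M}
    (h : ∀ x : X.obj c, f (basisElt k x) = g (basisElt k x)) : f = g :=
  linearMap_ext (X := X.obj c) h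

/-- Morphisms out of a free module. -/
def freeModHom {X : PartialPresheaf} {F : FIopMod k} (φ : ∀ c : FI, X.obj c → F.obj (op c))
    (h : ∀ {c d : FI} (i : d ⟶ c) (x : X.obj c),
      res F i (φ c x) = (X.res i x).elim 0 (φ d)) : freeMod k X ⟶ F :=
  mkHom (fun c => (Finsupp.linearCombination k (φ c) : (X.obj c →₀ k) →ₗ[k] F.obj (op c)))
    (by
      intro c d i x
      suffices H : (Finsupp.linearCombination k (φ d)).comp (pmap k (X.res i)) =
          (res F i).comp (Finsupp.linearCombination k (φ c)) from LinearMap.congr_fun H x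
      refine linearMap_ext fun x => ?_
      simp only [LinearMap.comp_apply, pmap_single, Finsupp.linearCombination_single, one_smul, h]
      cases X.res i x <;> simp)

@[simp] lemma freeModHom_basisElt {X : PartialPresheaf} {F : FIopMod k}
    (φ : ∀ c : FI, X.obj c → F.obj (op c))
    (h : ∀ {c d : FI} (i : d ⟶ c) (x : X.obj c),
      res F i (φ c x) = (X.res i x).elim 0 (φ d)) {c : FI} (x : X.obj c) :
    comp (freeModHom φ h) c (basisElt k x) = φ c x :=
  (Finsupp.linearCombination_single k 1 x).trans (one_smul k _)

lemma freeMod_hom_ext {X : PartialPresheaf} {F : FIopMod k} {φ ψ : freeMod k X ⟶ F}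
    (h : ∀ c (x : X.obj c), comp φ c (basisElt k x) = comp ψ c (basisElt k x)) : φ = ψ :=
  hom_ext fun c x => LinearMap.congr_fun (freeMod_linearMap_ext (h c)) x

/-- The morphism of free modules given by a natural partial map of bases. -/
def freeMap (k : Type u) [CommRing k] {X Y : PartialPresheaf}
    (φ : ∀ c : FI, X.obj c → Option (Y.obj c))
    (h : ∀ {c d : FI} (i : d ⟶ c) (x : X.obj c),
      (φ c x).bind (Y.res i) = (X.res i x).bind (φ d)) : freeMod k X ⟶ freeMod k Y :=
  mkHom (fun c => pmap k (φ c)) (by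
    intro c d i x
    suffices H : (pmap k (φ d)).comp (pmap k (X.res i)) =
        (pmap k (Y.res i)).comp (pmap k (φ c)) from LinearMap.congr_fun H x
    refine linearMap_ext fun x => ?_
    simp [pmap_gen, h])

/-! ### Representable modules and the modules representing primitives -/

/-- The representable presheaf. -/
def homPresheaf (b : FI) : PartialPresheaf where
  obj c := c ⟶ b
  res i f := some (i ≫ f)
  res_id c f := by simp
  res_comp i j f := by simp

/-- A morphism, as an element of the representable presheaf. -/
def homElt {c b : FI} (f : c ⟶ b) : (homPresheaf b).obj c := f

/-- The injection underlying a morphism of `FI`. -/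
def FI.fn {d c : FI} (i : d ⟶ c) : d.carrier ↪ c.carrier := i

@[simp] lemma FI.fn_comp {e d c : FI} (j : e ⟶ d) (i : d ⟶ c) (x : e.carrier) :
    FI.fn (j ≫ i) x = FI.fn i (FI.fn j x) := rfl

lemma FI.hom_ext {d c : FI} {i j : d ⟶ c} (h : ∀ x, FI.fn i x = FI.fn j x) : i = j :=
  Function.Embedding.ext h

/-- A property of maps to `A` is admissible if restrictions which satisfy it come in intervals. -/
abbrev Admissible {A : Type} (p : ∀ X : Type, (X → A) → Prop) : Prop :=
  ∀ {X Y Z : Type} (f : X → A) (i : Y → X) (j : Z → Y), Function.Injective i → p X f →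
    p Z (f ∘ i ∘ j) → p Y (f ∘ i)

open Classical in
/-- The maps to `A` with an admissible property, as a partial presheaf. -/
abbrev mapsPresheaf {A : Type} (p : ∀ X : Type, (X → A) → Prop) (hp : Admissible p) :
    PartialPresheaf where
  obj c := {f : c.carrier → A // p c.carrier f}
  res {c d} i f := if h : p d.carrier (f.1 ∘ FI.fn i) then some ⟨f.1 ∘ FI.fn i, h⟩ else none
  res_id c f := dif_pos f.2
  res_comp {c d e} i j f := by
    by_cases h : p d.carrier (f.1 ∘ FI.fn i)
    · rw [dif_pos h, Option.bind_some]
      rfl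
    · have h' : ¬ p e.carrier (f.1 ∘ FI.fn (j ≫ i)) := fun H =>
        h (hp f.1 (FI.fn i) (FI.fn j) (FI.fn i).injective f.2 H)
      rw [dif_neg h, dif_neg h', Option.bind_none]

section mapsPresheaf

variable {A : Type} {p : ∀ X : Type, (X → A) → Prop} (hp : Admissible p)

lemma mapsPresheaf_res_pos {c d : FI} (i : d ⟶ c) (f : (mapsPresheaf p hp).obj c)
    (h : p d.carrier (f.1 ∘ FI.fn i)) : (mapsPresheaf p hp).res i f = some ⟨f.1 ∘ FI.fn i, h⟩ :=
  dif_pos h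

lemma mapsPresheaf_res_neg {c d : FI} (i : d ⟶ c) (f : (mapsPresheaf p hp).obj c)
    (h : ¬ p d.carrier (f.1 ∘ FI.fn i)) : (mapsPresheaf p hp).res i f = none :=
  dif_neg h

end mapsPresheaf

lemma admissible_bijective {A : Type} :
    Admissible (A := A) fun _ f => Function.Bijective f := by
  intro X Y Z f i j hi hf h
  have hs : Function.Surjective (f ∘ i) := Function.Surjective.of_comp (g := j) h.2
  exact ⟨hf.1.comp hi, hs⟩

/-- The bijections onto `b`, as a partial presheaf. -/
abbrev bijPresheaf (b : FI) : PartialPresheaf :=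
  mapsPresheaf (A := b.carrier) (fun _ f => Function.Bijective f) admissible_bijective

/-- The bijection given by the identity. -/
def bijPresheafId (b : FI) : (bijPresheaf b).obj b := ⟨id, Function.bijective_id⟩

/-- The module with basis the bijections onto `b`; it represents the primitives at `b`. -/
abbrev bijMod (k : Type u) [CommRing k] (b : FI) : FIopMod k :=
  freeMod k (bijPresheaf b)

/-- The identity of `b`, as an element of `bijMod k b`. -/
def bijModId (k : Type u) [CommRing k] (b : FI) : (bijMod k b).obj (op b) :=
  basisElt k (bijPresheafId b)

/-- The submodule of elements killed by the restrictions along nonsurjective maps. -/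
def prim (F : FIopMod k) (b : FI) : Submodule k (F.obj (op b)) where
  carrier := {x | ∀ (d : FI) (i : d ⟶ b), ¬ Function.Surjective (FI.fn i) → res F i x = 0}
  add_mem' {x y} hx hy d i hi := by rw [map_add, hx d i hi, hy d i hi, add_zero]
  zero_mem' d i _ := map_zero _
  smul_mem' r x hx d i hi := by rw [map_smul, hx d i hi, smul_zero]

/-- A nonsurjective injection factors through the inclusion of its image, which is a proper subset.
-/
lemma primitives_eq_prim (F : FIopMod k) (b : FI) : primitives F ⟨b.carrier⟩ = prim F b := by
  ext x
  rw [mem_primitives_iff]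
  constructor
  · intro h d i hi
    have hs : Set.range (FI.fn i) ≠ Set.univ := fun H => hi (Set.range_eq_univ.1 H)
    let q : d ⟶ inclFB.obj (FB.sub ⟨b.carrier⟩ (Set.range (FI.fn i))) :=
      FI.ofEmb ⟨fun y => ⟨FI.fn i y, y, rfl⟩, fun y z hyz =>
        (FI.fn i).injective (Subtype.ext_iff.1 hyz)⟩
    have hq : i = q ≫ FB.subIncl ⟨b.carrier⟩ (Set.range (FI.fn i)) := rfl
    have h1 := res_comp F (FB.subIncl ⟨b.carrier⟩ (Set.range (FI.fn i))) q x
    rw [← hq] at h1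
    exact h1.trans ((congrArg (res F q) (h _ hs)).trans (map_zero _))
  · intro h s hs
    refine h _ (FB.subIncl ⟨b.carrier⟩ s) fun H => hs ?_
    refine Set.eq_univ_of_forall fun y => ?_
    obtain ⟨z, rfl⟩ := H y
    exact z.2

/-- This is the naturality required for a morphism out of `bijMod k b`: a restriction that stops
being bijective onto `b` kills a primitive element, just as it is undefined on the basis. -/
lemma prim_res_of_surjective_unique {F : FIopMod k} {b : FI} {x : F.obj (op b)} (hx : x ∈ prim F b)
    {c : FI} (f : (bijPresheaf b).obj c) {d : FI} (i : d ⟶ c) :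
    res F i (res F (FI.ofEmb ⟨f.1, f.2.1⟩ : c ⟶ b) x) =
      ((bijPresheaf b).res i f).elim 0
        fun g => res F (FI.ofEmb ⟨g.1, g.2.1⟩ : d ⟶ b) x := by
  rw [← res_comp]
  by_cases h : Function.Bijective (f.1 ∘ FI.fn i)
  · rw [mapsPresheaf_res_pos admissible_bijective i f h]
    rfl
  · rw [mapsPresheaf_res_neg admissible_bijective i f h]
    refine hx _ _ fun hs => h ⟨f.2.1.comp (FI.fn i).injective, hs⟩

lemma bijModId_mem_prim (b : FI) : bijModId k b ∈ prim (bijMod k b) b := by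
  intro d i hi
  refine (freeMod_res_basisElt i _).trans ?_
  rw [mapsPresheaf_res_neg admissible_bijective]
  · rfl
  · exact fun h => hi h.2

lemma comp_mem_prim {F G : FIopMod k} (φ : F ⟶ G) {b : FI} {x : F.obj (op b)}
    (hx : x ∈ prim F b) : comp φ b x ∈ prim G b := fun d i hi => by
  rw [← comp_res, hx d i hi, map_zero]

/-- Morphisms out of `bijMod k b` are primitive elements. -/
def bijModHomEquiv (F : FIopMod k) (b : FI) : (bijMod k b ⟶ F) ≃ₗ[k] prim F b where
  toFun φ := ⟨comp φ b (bijModId k b), comp_mem_prim φ (bijModId_mem_prim b)⟩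
  map_add' φ ψ := rfl
  map_smul' r φ := rfl
  invFun x := freeModHom (fun c f => res F (FI.ofEmb ⟨f.1, f.2.1⟩ : c ⟶ b) x.1)
    (fun i f => prim_res_of_surjective_unique x.2 f i)
  left_inv φ := by
    -- Yoneda: a generator `f` is the restriction of `bijModId` along `f` itself.
    refine freeMod_hom_ext fun c f => ?_
    rw [freeModHom_basisElt]
    dsimp only
    rw [← comp_res]
    congr 1
    refine (freeMod_res_basisElt _ _).trans ?_
    rw [mapsPresheaf_res_pos admissible_bijective _ _ (show Function.Bijective (id ∘ f.1) from f.2)]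
    rfl
  right_inv x := by
    ext1
    refine (freeModHom_basisElt _ _ _).trans ?_
    exact res_id F b x.1

lemma bijModHomEquiv_comp {F G : FIopMod k} {b : FI} (φ : bijMod k b ⟶ F) (ψ : F ⟶ G) :
    (bijModHomEquiv G b (φ ≫ ψ)).1 = comp ψ b (bijModHomEquiv F b φ).1 := rfl

/-! ### Restriction maps of injective modules -/

/-- The representable `FI^op`-module. -/
abbrev repMod (k : Type u) [CommRing k] (b : FI) : FIopMod k := freeMod k (homPresheaf b)

/-- The morphism from a representable module given by an element. -/
def repModHom {F : FIopMod k} {b : FI} (x : F.obj (op b)) : repMod k b ⟶ F :=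
  freeModHom (fun c (f : c ⟶ b) => res F f x) (fun i f => (res_comp F f i x).symm)

lemma repModHom_homElt {F : FIopMod k} {b c : FI} (x : F.obj (op b)) (f : c ⟶ b) :
    comp (repModHom x) c (basisElt k (homElt f)) = res F f x :=
  freeModHom_basisElt (X := homPresheaf b) _ (fun i f => (res_comp F f i x).symm) _

lemma pmap_some_injective {X Y : Type} (f : X → Y) (hf : Function.Injective f) :
    Function.Injective (pmap k fun x => some (f x)) := by
  have : (pmap k fun x => some (f x)) = Finsupp.lmapDomain k k f := by
    refine linearMap_ext fun x => ?_
    simp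
  rw [this]
  exact Finsupp.mapDomain_injective hf

/-- An element at `d` is a morphism from the representable module of `d`. Composition with `i`
embeds that module into the representable module of `c`, and injectivity extends the morphism, that
is, lifts the element to `c`. -/
lemma res_surjective_of_injective (I : FIopMod k) [Injective I] {c d : FI} (i : d ⟶ c) :
    Function.Surjective (res I i) := by
  intro x
  let φ : repMod k d ⟶ repMod k c :=
    freeMap k (X := homPresheaf d) (Y := homPresheaf c) (fun e (f : e ⟶ d) => some (f ≫ i))
      (fun j f => congrArg some (Category.assoc _ _ _).symm)
  have : Mono φ := (mono_iff φ).2 fun e => pmap_some_injective (fun f : e ⟶ d => f ≫ i) (by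
    intro f g h
    refine FI.hom_ext fun y => (FI.fn i).injective ?_
    exact congrArg (fun t => FI.fn t y) h)
  let ψ := Injective.factorThru (repModHom x) φ
  have h : φ ≫ ψ = repModHom x := Injective.comp_factorThru _ _
  refine ⟨comp ψ c (basisElt k (homElt (𝟙 c))), ?_⟩
  rw [← comp_res, freeMod_res_basisElt]
  have h1 : comp (φ ≫ ψ) d (basisElt k (homElt (𝟙 d))) = x := by
    rw [h]
    rw [repModHom_homElt, res_id]
  refine Eq.trans ?_ h1
  change comp ψ d (basisElt k (homElt (i ≫ 𝟙 c))) =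
    comp ψ d (comp φ d (basisElt k (homElt (𝟙 d))))
  congr 1
  refine Eq.trans ?_ (pmap_single (k := k) _ _).symm
  simp only [Category.comp_id]
  rfl


/-! ## The difference functor -/

/-- A finite set with a point added. -/
abbrev FI.opt (c : FI) : FI := ⟨Option c.carrier⟩

/-- The extension of an injection to the sets with a point added. -/
def FI.optMap {d c : FI} (i : d ⟶ c) : d.opt ⟶ c.opt := FI.ofEmb (FI.fn i).optionMap

/-- The inclusion of a finite set into the set with a point added. -/
def FI.inc (c : FI) : c ⟶ c.opt := FI.ofEmb Function.Embedding.some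

@[simp] lemma FI.fn_optMap_some {d c : FI} (i : d ⟶ c) (x : d.carrier) :
    FI.fn (FI.optMap i) (some x) = some (FI.fn i x) := rfl

lemma FI.optMap_id (c : FI) : FI.optMap (𝟙 c) = 𝟙 c.opt :=
  FI.hom_ext fun x => by cases x <;> rfl

lemma FI.optMap_comp {e d c : FI} (j : e ⟶ d) (i : d ⟶ c) :
    FI.optMap (j ≫ i) = FI.optMap j ≫ FI.optMap i :=
  FI.hom_ext fun x => by cases x <;> rfl

lemma FI.inc_optMap {d c : FI} (i : d ⟶ c) : d.inc ≫ FI.optMap i = i ≫ c.inc := rfl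

/-- The elements at `c ⊔ {*}` which restrict to zero on `c`. -/
abbrev diffSub (F : FIopMod k) (c : FI) : Submodule k (F.obj (op c.opt)) :=
  LinearMap.ker (res F c.inc)

lemma res_mem_diffSub {F : FIopMod k} {c d : FI} (i : d ⟶ c) {x : F.obj (op c.opt)}
    (hx : x ∈ diffSub F c) : res F (FI.optMap i) x ∈ diffSub F d := by
  rw [LinearMap.mem_ker] at hx ⊢
  rw [← res_comp, FI.inc_optMap, res_comp, hx, map_zero]

/-- The difference module of an `FI^op`-module. -/
def diff (F : FIopMod k) : FIopMod k where
  obj c := ModuleCat.of k (diffSub F c.unop)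
  map i := ModuleCat.ofHom ((res F (FI.optMap i.unop)).restrict fun _ hx => res_mem_diffSub _ hx)
  map_id c := by
    ext x
    refine (congrArg (fun j => res F j x.1) (FI.optMap_id c.unop)).trans ?_
    exact res_id F _ x.1
  map_comp i j := by
    ext x
    refine (congrArg (fun j => res F j x.1) (FI.optMap_comp j.unop i.unop)).trans ?_
    exact res_comp F _ _ x.1

/-- The inclusion of the difference module into the shifted module. -/
def diffVal {F : FIopMod k} {c : FI} : (diff F).obj (op c) →ₗ[k] F.obj (op c.opt) :=
  (diffSub F c).subtype

/-- An element of the difference module. -/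
def diffMk {F : FIopMod k} {c : FI} (x : F.obj (op c.opt)) (hx : res F c.inc x = 0) :
    (diff F).obj (op c) := (⟨x, hx⟩ : diffSub F c)

@[simp] lemma diffVal_diffMk {F : FIopMod k} {c : FI} (x : F.obj (op c.opt))
    (hx : res F c.inc x = 0) : diffVal (diffMk x hx) = x := rfl

lemma diffVal_injective (F : FIopMod k) (c : FI) :
    Function.Injective (diffVal : (diff F).obj (op c) →ₗ[k] F.obj (op c.opt)) :=
  Subtype.val_injective

lemma res_inc_diffVal {F : FIopMod k} {c : FI} (x : (diff F).obj (op c)) :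
    res F c.inc (diffVal x) = 0 := LinearMap.mem_ker.1 (Subtype.prop (p := (· ∈ diffSub F c)) x)

lemma diffVal_res {F : FIopMod k} {c d : FI} (i : d ⟶ c) (x : (diff F).obj (op c)) :
    diffVal (res (diff F) i x) = res F (FI.optMap i) (diffVal x) := rfl

/-- The morphism of difference modules induced by a morphism. -/
def diffMap {F G : FIopMod k} (φ : F ⟶ G) : diff F ⟶ diff G :=
  mkHom (fun c => (comp φ c.opt).restrict fun x (hx : x ∈ diffSub F c) => by
      rw [LinearMap.mem_ker] at hx ⊢
      rw [← comp_res, hx, map_zero])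
    fun i x => Subtype.ext (comp_res φ (FI.optMap i) (diffVal x))

/-- The restriction maps along the inclusions `c ⊆ c ⊔ {*}` are surjective. -/
def IncSurjective (F : FIopMod k) : Prop :=
  ∀ c : FI, Function.Surjective (res F c.inc)

/-- The short complex of difference modules. -/
abbrev diffShortComplex (S : ShortComplex (FIopMod k)) : ShortComplex (FIopMod k) where
  X₁ := diff S.X₁
  X₂ := diff S.X₂
  X₃ := diff S.X₃
  f := diffMap S.f
  g := diffMap S.g
  zero := hom_ext fun c x => diffVal_injective _ _
    (congrArg (fun φ => comp φ c.opt (diffVal x)) S.zero)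

/-- A snake lemma argument: the only obstruction to lifting along `diff S.g` is the cokernel of the
restriction on `S.X₁`, so surjectivity is needed there alone. -/
lemma diffShortComplex_shortExact {S : ShortComplex (FIopMod k)} (hS : S.ShortExact)
    (h : IncSurjective S.X₁) : (diffShortComplex S).ShortExact := by
  have hf := (mono_iff S.f).1 hS.mono_f
  have hg := (epi_iff S.g).1 hS.epi_g
  refine shortExact_of_app (fun c x y hxy => ?_) (fun c z => ?_) (fun c x hx => ?_)
  · refine diffVal_injective _ _ (hf c.opt ?_)
    exact congrArg diffVal hxy
  · obtain ⟨y, hy⟩ := hg c.opt (diffVal z)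
    have h1 : comp S.g c (res S.X₂ c.inc y) = 0 := by
      rw [comp_res, hy, res_inc_diffVal]
    obtain ⟨x, hx⟩ := exact_app hS.exact c _ h1
    obtain ⟨x', rfl⟩ := h c x
    refine ⟨diffMk (y - comp S.f c.opt x') ?_, diffVal_injective _ _ ?_⟩
    · rw [map_sub, ← comp_res, hx, sub_self]
    · refine (map_sub (comp S.g c.opt) y _).trans ?_
      rw [hy]
      have := congrArg (fun φ => comp φ c.opt x') S.zero
      exact (congrArg (diffVal z - ·) this).trans (sub_zero _)
  · obtain ⟨y, hy⟩ := exact_app hS.exact c.opt (diffVal x) (congrArg diffVal hx)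
    refine ⟨diffMk y (hf c ?_), diffVal_injective _ _ hy⟩
    rw [comp_res, hy, res_inc_diffVal, map_zero]

/-! ### Primitives of the difference module -/

/-- If a nonsurjective injection into `c ⊔ {*}` hits the added point, it factors through `optMap` of
a nonsurjective injection into `c`. If it misses the point, it factors through `c`, where elements
of the difference module vanish by definition. -/
lemma diffVal_mem_prim_iff {F : FIopMod k} {c : FI} (x : (diff F).obj (op c)) :
    diffVal x ∈ prim F c.opt ↔ x ∈ prim (diff F) c := by
  constructor
  · intro h d i hi
    refine diffVal_injective _ _ (h _ (FI.optMap i) fun hs => hi fun y => ?_)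
    obtain ⟨z, hz⟩ := hs (some y)
    cases z with
    | none => exact absurd hz (Option.some_ne_none y).symm
    | some z => exact ⟨z, Option.some_injective _ hz⟩
  · intro h d i hi
    by_cases hn : none ∈ Set.range (FI.fn i)
    · let d' : FI := ⟨{y : c.carrier // some y ∈ Set.range (FI.fn i)}⟩
      let j : d' ⟶ c := FI.ofEmb (Function.Embedding.subtype _)
      let q' : d.carrier → d'.opt.carrier := fun z =>
        (FI.fn i z).pmap (fun y (hy : some y ∈ Set.range (FI.fn i)) => (⟨y, hy⟩ : d'.carrier))
          fun y hy => ⟨z, hy⟩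
      have hq' : ∀ z, FI.fn (FI.optMap j) (q' z) = FI.fn i z := fun z => by
        dsimp only [q']
        generalize_proofs hp
        revert hp
        cases FI.fn i z with
        | none => exact fun _ => rfl
        | some y => exact fun _ => rfl
      let q : d ⟶ d'.opt := FI.ofEmb ⟨q', fun _ _ hyz => (FI.fn i).injective (by
        rw [← hq', ← hq', hyz])⟩
      have hq : i = q ≫ FI.optMap j := FI.hom_ext fun z => (hq' z).symm
      rw [hq, res_comp, ← diffVal_res, h d' j, map_zero, map_zero]
      intro hs
      refine hi fun y => ?_
      cases y with
      | none => exact hn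
      | some y =>
        obtain ⟨z, rfl⟩ := hs y
        exact z.2
    · have hsome : ∀ z, (FI.fn i z).isSome := fun z => by
        rw [Option.isSome_iff_ne_none]
        exact fun hz => hn ⟨z, hz⟩
      let q : d ⟶ c := FI.ofEmb ⟨fun z => (FI.fn i z).get (hsome z), fun _ _ hyz =>
        (FI.fn i).injective (Option.get_inj.1 hyz)⟩
      have hq : i = q ≫ c.inc := FI.hom_ext fun z => (Option.some_get (hsome z)).symm
      rw [hq, res_comp, res_inc_diffVal, map_zero]

/-- Primitives at `c ⊔ {*}` are primitives of the difference module at `c`. -/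
def primDiffEquiv (F : FIopMod k) (c : FI) : prim F c.opt ≃ₗ[k] prim (diff F) c where
  toFun x := ⟨diffMk x.1 (x.2 _ _ fun hs => (hs none).elim fun y hy => by cases hy),
    (diffVal_mem_prim_iff _).1 x.2⟩
  map_add' x y := rfl
  map_smul' r x := rfl
  invFun x := ⟨diffVal x.1, (diffVal_mem_prim_iff _).2 x.2⟩
  left_inv x := rfl
  right_inv x := rfl

/-- Morphisms out of `bijMod k c.opt` are morphisms out of `bijMod k c` to the difference
module. -/
def bijModOptHomEquiv (F : FIopMod k) (c : FI) :
    (bijMod k c.opt ⟶ F) ≃ₗ[k] (bijMod k c ⟶ diff F) :=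
  (bijModHomEquiv F c.opt).trans ((primDiffEquiv F c).trans (bijModHomEquiv (diff F) c).symm)

lemma bijModOptHomEquiv_comp {F G : FIopMod k} {c : FI} (φ : bijMod k c.opt ⟶ F) (ψ : F ⟶ G) :
    bijModOptHomEquiv G c (φ ≫ ψ) = bijModOptHomEquiv F c φ ≫ diffMap ψ := by
  apply (bijModHomEquiv (diff G) c).injective
  ext1
  rw [bijModHomEquiv_comp]
  simp only [bijModOptHomEquiv, LinearEquiv.trans_apply, LinearEquiv.apply_symm_apply]
  rfl

/-! ### The difference module of an injective module -/

/-- The complement of a point of a finite set. -/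
def FI.compl (c : FI) (x : c.carrier) : FI := ⟨{y : c.carrier // y ≠ x}⟩

/-- The restriction of an injection `d → c` to the complements of `x` and its image. -/
def FI.complMap {d c : FI} (i : d ⟶ c) (x : d.carrier) : d.compl x ⟶ c.compl (FI.fn i x) :=
  FI.ofEmb ⟨fun y => ⟨FI.fn i y.1, fun h => y.2 ((FI.fn i).injective h)⟩, fun _ _ h =>
    Subtype.ext ((FI.fn i).injective (Subtype.ext_iff.1 h))⟩

open Classical in
/-- The identification of `c` with the complement of `x`, with a point added. -/
def FI.splitOff (c : FI) (x : c.carrier) : c ⟶ (c.compl x).opt :=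
  FI.ofEmb ⟨fun y => if h : y = x then none else some ⟨y, h⟩, fun y z h => by
    dsimp only at h
    split_ifs at h with hy hz hz
    · rw [hy, hz]
    · exact Subtype.ext_iff.1 (Option.some_injective _ h)⟩

lemma FI.splitOff_self {c : FI} (x : c.carrier) : FI.fn (c.splitOff x) x = none := dif_pos rfl

lemma FI.splitOff_of_ne {c : FI} {x y : c.carrier} (h : y ≠ x) :
    FI.fn (c.splitOff x) y = some ⟨y, h⟩ := dif_neg h

lemma FI.splitOff_optMap {d c : FI} (i : d ⟶ c) (x : d.carrier) :
    d.splitOff x ≫ FI.optMap (FI.complMap i x) = i ≫ c.splitOff (FI.fn i x) := by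
  refine FI.hom_ext fun y => ?_
  change FI.fn (FI.optMap (FI.complMap i x)) (FI.fn (d.splitOff x) y) =
    FI.fn (c.splitOff (FI.fn i x)) (FI.fn i y)
  by_cases h : y = x
  · subst h
    rw [FI.splitOff_self, FI.splitOff_self]
    rfl
  · rw [FI.splitOff_of_ne h, FI.splitOff_of_ne fun H => h ((FI.fn i).injective H)]
    rfl

/-- The left adjoint of the difference functor, on objects. -/
def codiff (F : FIopMod k) : FIopMod k where
  obj c := ModuleCat.of k (∀ x : c.unop.carrier, F.obj (op (c.unop.compl x)))
  map i := ModuleCat.ofHom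
    (LinearMap.pi fun x => (res F (FI.complMap i.unop x)).comp (LinearMap.proj (FI.fn i.unop x)))
  map_id c := by
    ext v x
    exact res_id F (c.unop.compl x) (v x)
  map_comp i j := by
    ext v x
    exact res_comp F (FI.complMap i.unop (FI.fn j.unop x)) (FI.complMap j.unop x) _

/-- The components of an element of `codiff F`. -/
def codiffProj {F : FIopMod k} {c : FI} (x : c.carrier) :
    (codiff F).obj (op c) →ₗ[k] F.obj (op (c.compl x)) :=
  LinearMap.proj (R := k) (φ := fun x : c.carrier => F.obj (op (c.compl x))) x

lemma codiff_ext {F : FIopMod k} {c : FI} {v w : (codiff F).obj (op c)}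
    (h : ∀ x, codiffProj x v = codiffProj x w) : v = w := funext h

lemma codiffProj_res {F : FIopMod k} {d c : FI} (i : d ⟶ c) (v : (codiff F).obj (op c))
    (x : d.carrier) :
    codiffProj x (res (codiff F) i v) = res F (FI.complMap i x) (codiffProj (FI.fn i x) v) := rfl

/-- The morphism of `codiff` modules induced by a morphism. -/
def codiffMap {F G : FIopMod k} (φ : F ⟶ G) : codiff F ⟶ codiff G :=
  mkHom (fun c => LinearMap.pi fun x => (comp φ (c.compl x)).comp (codiffProj x))
    fun i v => codiff_ext fun x => comp_res φ (FI.complMap i x) (codiffProj (FI.fn i x) v)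

lemma codiffProj_comp_codiffMap {F G : FIopMod k} (φ : F ⟶ G) {c : FI}
    (v : (codiff F).obj (op c)) (x : c.carrier) :
    codiffProj x (comp (codiffMap φ) c v) = comp φ (c.compl x) (codiffProj x v) := rfl

lemma codiffMap_mono {F G : FIopMod k} (φ : F ⟶ G) [Mono φ] : Mono (codiffMap φ) := by
  rw [mono_iff]
  have h := (mono_iff φ).1 inferInstance
  exact fun c v w hvw => codiff_ext fun x => h _ (congrArg (codiffProj x) hvw)

open Classical in
/-- The transpose of a morphism to a difference module. -/
def codiffTranspose {F G : FIopMod k} (φ : F ⟶ diff G) : codiff F ⟶ G :=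
  letI := fun c : FI => Fintype.ofFinite c.carrier
  mkHom (fun c => ∑ x : c.carrier, (res G (c.splitOff x)).comp
      (diffVal.comp ((comp φ (c.compl x)).comp (codiffProj x)))) (by
    intro c d i v
    simp only [LinearMap.sum_apply, map_sum, LinearMap.comp_apply]
    have h1 : ∀ x : d.carrier, res G (d.splitOff x) (diffVal (comp φ (d.compl x)
        (codiffProj x (res (codiff F) i v)))) =
        res G i (res G (c.splitOff (FI.fn i x)) (diffVal (comp φ (c.compl (FI.fn i x))
          (codiffProj (FI.fn i x) v)))) := by
      intro x
      rw [codiffProj_res, comp_res, diffVal_res, ← res_comp, ← res_comp, FI.splitOff_optMap]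
    rw [Finset.sum_congr rfl fun x _ => h1 x]
    -- Naturality of the summands matches the points of `d` with those in the image of `i`. For `x`
    -- outside the image, `i` lands in the complement of `x`, so the summand restricts through `inc`
    -- and vanishes.
    refine Finset.sum_of_injOn (FI.fn i) (FI.fn i).injective.injOn (by simp) ?_ (by simp)
    intro x _ hx
    have hx' : ∀ y, FI.fn i y ≠ x := fun y hy => hx ⟨y, by simp, hy⟩
    let q : d ⟶ c.compl x := FI.ofEmb ⟨fun y => ⟨FI.fn i y, hx' y⟩, fun y z h =>
      (FI.fn i).injective (Subtype.ext_iff.1 h)⟩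
    have hq : i ≫ c.splitOff x = q ≫ (c.compl x).inc :=
      FI.hom_ext fun y => FI.splitOff_of_ne (hx' y)
    rw [← res_comp, hq, res_comp, res_inc_diffVal, map_zero])

lemma comp_codiffTranspose {F G : FIopMod k} (φ : F ⟶ diff G) (c : FI) [Fintype c.carrier]
    (v : (codiff F).obj (op c)) :
    comp (codiffTranspose φ) c v =
      ∑ x, res G (c.splitOff x) (diffVal (comp φ (c.compl x) (codiffProj x v))) := by
  refine Eq.trans (LinearMap.sum_apply _ _ _) ?_
  congr!

/-- The identification of `c` with the complement of the added point. -/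
def FI.complNone (c : FI) : c.opt.compl none ⟶ c :=
  FI.ofEmb ⟨fun y => y.1.get (Option.isSome_iff_ne_none.2 y.2), fun _ _ h =>
    Subtype.ext (Option.get_inj.1 h)⟩

lemma FI.some_complNone {c : FI} (y : (c.opt.compl none).carrier) :
    some (FI.fn c.complNone y) = y.1 := Option.some_get _

/-- The element of `codiff F` at `c ⊔ {*}` given by an element of `F` at `c`. -/
def codiffSingle {F : FIopMod k} (c : FI) :
    F.obj (op c) →ₗ[k] (codiff F).obj (op c.opt) :=
  LinearMap.pi fun x => match x with
    | none => res F c.complNone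
    | some _ => 0

lemma codiffProj_none_codiffSingle {F : FIopMod k} {c : FI} (w : F.obj (op c)) :
    codiffProj none (codiffSingle c w) = res F c.complNone w := rfl

lemma codiffProj_some_codiffSingle {F : FIopMod k} {c : FI} (w : F.obj (op c)) (x : c.carrier) :
    codiffProj (some x) (codiffSingle c w) = 0 := rfl

lemma res_inc_codiffSingle {F : FIopMod k} {c : FI} (w : F.obj (op c)) :
    res (codiff F) c.inc (codiffSingle c w) = 0 :=
  codiff_ext fun x => by
    rw [codiffProj_res]
    exact (congrArg _ (codiffProj_some_codiffSingle w x)).trans (map_zero _)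

lemma codiffSingle_res {F : FIopMod k} {d c : FI} (i : d ⟶ c) (w : F.obj (op c)) :
    codiffSingle d (res F i w) = res (codiff F) (FI.optMap i) (codiffSingle c w) := by
  refine codiff_ext fun x => ?_
  rw [codiffProj_res]
  cases x with
  | none =>
    rw [codiffProj_none_codiffSingle]
    let j : d.opt.compl none ⟶ c.opt.compl none := FI.complMap (FI.optMap i) none
    refine (res_comp F i d.complNone w).symm.trans
      (Eq.trans ?_ (res_comp F c.complNone j w))
    refine congrArg (fun j => res F j w) ?_
    refine FI.hom_ext fun y => Option.some_injective _ ?_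
    rw [FI.fn_comp, FI.fn_comp, FI.some_complNone]
    have := FI.some_complNone y
    rw [← FI.fn_optMap_some, this]
    rfl
  | some x =>
    exact (map_zero _).symm

/-- The transpose of a morphism out of `codiff F`. -/
def codiffUntranspose {F G : FIopMod k} (ψ : codiff F ⟶ G) : F ⟶ diff G :=
  mkHom (fun c => ((comp ψ c.opt).comp (codiffSingle c)).codRestrict (diffSub G c) fun w => by
      rw [LinearMap.mem_ker, LinearMap.comp_apply, ← comp_res, res_inc_codiffSingle, map_zero])
    fun {c d} i w => Subtype.ext (by
      change comp ψ d.opt (codiffSingle d (res F i w)) =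
        res G (FI.optMap i) (comp ψ c.opt (codiffSingle c w))
      rw [codiffSingle_res, comp_res])

lemma diffVal_codiffUntranspose {F G : FIopMod k} (ψ : codiff F ⟶ G) {c : FI} (w : F.obj (op c)) :
    diffVal (comp (codiffUntranspose ψ) c w) = comp ψ c.opt (codiffSingle c w) := rfl

/-- This half of the adjunction, with naturality in the source, suffices for transporting
injectivity. -/
lemma codiffUntranspose_transpose {F G : FIopMod k} (φ : F ⟶ diff G) :
    codiffUntranspose (codiffTranspose φ) = φ := by
  refine FIop.hom_ext fun c w => diffVal_injective _ _ ?_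
  rw [diffVal_codiffUntranspose]
  let : Fintype c.opt.carrier := Fintype.ofFinite _
  rw [comp_codiffTranspose, Finset.sum_eq_single none]
  · rw [codiffProj_none_codiffSingle, comp_res, diffVal_res, ← res_comp]
    refine (congrArg (fun j => res G j _) ?_).trans (res_id G _ _)
    refine FI.hom_ext fun y => ?_
    rw [FI.fn_comp]
    cases y with
    | none => rw [FI.splitOff_self]; rfl
    | some y => rw [FI.splitOff_of_ne (by simp)]; rfl
  · intro x _ hx
    cases x with
    | none => exact absurd rfl hx
    | some x => rw [codiffProj_some_codiffSingle, map_zero, map_zero, map_zero]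
  · simp

lemma comp_codiffUntranspose {F F' G : FIopMod k} (m : F ⟶ F') (ψ : codiff F' ⟶ G) :
    m ≫ codiffUntranspose ψ = codiffUntranspose (codiffMap m ≫ ψ) := by
  refine FIop.hom_ext fun c w => diffVal_injective _ _ ?_
  change comp ψ c.opt (codiffSingle c (comp m c w)) =
    comp ψ c.opt (comp (codiffMap m) c.opt (codiffSingle c w))
  congr 1
  refine codiff_ext fun x => ?_
  rw [codiffProj_comp_codiffMap]
  cases x with
  | none => exact (comp_res m _ w).symm
  | some x => exact (map_zero _).symm

/-- The extension problem is transposed to `codiff`, which preserves monomorphisms, solved in `I`,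
and transposed back. -/
instance diff_injective (I : FIopMod k) [Injective I] : Injective (diff I) where
  factors {F F'} φ m _ := by
    have := codiffMap_mono m
    refine ⟨codiffUntranspose (Injective.factorThru (codiffTranspose φ) (codiffMap m)), ?_⟩
    rw [comp_codiffUntranspose, Injective.comp_factorThru, codiffUntranspose_transpose]

lemma incSurjective_of_injective (I : FIopMod k) [Injective I] : IncSurjective I :=
  fun c => res_surjective_of_injective I c.inc

lemma IncSurjective.of_epi {F G : FIopMod k} (φ : F ⟶ G) [Epi φ] (h : IncSurjective F) :
    IncSurjective G := fun c y => by
  obtain ⟨x, rfl⟩ := (epi_iff φ).1 inferInstance c y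
  obtain ⟨z, rfl⟩ := h c x
  exact ⟨comp φ _ z, (comp_res φ _ _).symm⟩

end FIop

/-! ### Ext classes represented by cocycles in an injective resolution -/

namespace CategoryTheory.InjectiveResolution

open Abelian CochainComplex HomComplex

universe w v u'

variable {C : Type u'} [Category.{v} C] [Abelian C] [HasExt.{w} C] {X Y : C}
  (R : InjectiveResolution Y)

/-- The resolution vanishes in degree `-1`, so a coboundary in degree `0` is zero. -/
lemma extMk_zero_eq_zero_iff (f : X ⟶ R.cocomplex.X 0) (m : ℕ) (hm : 0 + 1 = m)
    (hf : f ≫ R.cocomplex.d 0 m = 0) : R.extMk f m hm hf = 0 ↔ f = 0 := by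
  constructor
  · intro h
    rw [← R.extEquivCohomologyClass.apply_eq_iff_eq, extEquivCohomologyClass_extMk,
      extEquivCohomologyClass_zero, CohomologyClass.mk_eq_zero_iff,
      Cocycle.fromSingleMk_mem_coboundaries_iff _ _ _ _ _ (-1) (by lia)] at h
    obtain ⟨g, hg⟩ := h
    have hg0 : g = 0 :=
      (R.cochainComplex.isZero_of_isStrictlyGE 0 (-1) (by lia)).eq_of_tgt _ _
    rw [← cancel_mono (R.cochainComplexXIso _ 0 rfl).inv, ← hg, hg0, zero_comp, zero_comp]
  · rintro rfl
    exact R.extMk_zero m hm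

/-- Scalars act on `Ext` by precomposition with `r • 𝟙 X`, which is visible on cocycles. -/
lemma extMk_smul {k : Type*} [Ring k] [Linear k C] {n : ℕ} (r : k) (f : X ⟶ R.cocomplex.X n)
    (m : ℕ) (hm : n + 1 = m) (hf : f ≫ R.cocomplex.d n m = 0) :
    R.extMk (r • f) m hm (by rw [Linear.smul_comp, hf, smul_zero]) = r • R.extMk f m hm hf := by
  have h := R.mk₀_comp_extMk f m hm hf (r • 𝟙 X)
  rw [Ext.mk₀_smul, Ext.smul_comp, Ext.mk₀_id_comp] at h
  rw [h]
  congr 1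
  simp

end CategoryTheory.InjectiveResolution

namespace FIop

variable {k : Type u} [CommRing k]

open Abelian

/-! ## Cohomology as `Ext` -/

/-- `FI` is a large category with objects in `Type 1`, so natural transformations live in universe
`max 1 u`. -/
instance : HasExt.{max 1 u} (FIopMod k) := hasExt_of_enoughInjectives _

/-- The groups `Ext^n` out of the module representing the primitives at `c`. -/
abbrev H (n : ℕ) (c : FI) (F : FIopMod k) : Type (max 1 u) := Ext (bijMod k c) F n

/-- The two descriptions of primitives agree. -/
def primitivesEquivPrim (F : FIopMod k) (c : FI) : primitives F ⟨c.carrier⟩ ≃ₗ[k] prim F c where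
  toFun x := ⟨x.1, by rw [← primitives_eq_prim]; exact x.2⟩
  invFun x := ⟨x.1, by rw [primitives_eq_prim]; exact x.2⟩
  map_add' _ _ := rfl
  map_smul' _ _ := rfl
  left_inv _ := rfl
  right_inv _ := rfl

/-- Primitives at `c` are morphisms out of `bijMod k c`. -/
def primitivesEquivHom (F : FIopMod k) (c : FI) :
    ((H0 k).obj F).obj (op ⟨c.carrier⟩) ≃ₗ[k] (bijMod k c ⟶ F) :=
  (primitivesEquivPrim F c).trans (bijModHomEquiv F c).symm

lemma primitivesEquivHom_map {F G : FIopMod k} (φ : F ⟶ G) (c : FI)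
    (x : ((H0 k).obj F).obj (op ⟨c.carrier⟩)) :
    primitivesEquivHom G c ((((H0 k).map φ).app (op ⟨c.carrier⟩)).hom x) =
      primitivesEquivHom F c x ≫ φ := by
  apply (bijModHomEquiv G c).injective
  ext1
  rw [bijModHomEquiv_comp]
  have h : ∀ (F : FIopMod k) (x : ((H0 k).obj F).obj (op ⟨c.carrier⟩)),
      bijModHomEquiv F c (primitivesEquivHom F c x) = primitivesEquivPrim F c x :=
    fun F x => LinearEquiv.apply_symm_apply _ _
  rw [h, h]
  rfl

section cohomologyEquiv

variable {F : FIopMod k} (I : InjectiveResolution F) (n : ℕ) (c : FI)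

/-- The complex of primitives at `c` of an injective resolution, in degree `n`. -/
def primComplex : ShortComplex (ModuleCat.{u} k) :=
  ((((H0 k).mapHomologicalComplex _).obj I.cocomplex).sc' ((ComplexShape.up ℕ).prev n) n
    (n + 1)).map ((evaluation _ _).obj (op ⟨c.carrier⟩))

/-- The elements of the complex of primitives, as morphisms. -/
def primComplexHom : (primComplex I n c).X₂ ≃ₗ[k] (bijMod k c ⟶ I.cocomplex.X n) :=
  primitivesEquivHom (I.cocomplex.X n) c

lemma primComplexHom_d_eq_zero_iff (x : (primComplex I n c).X₂) :
    primComplexHom I n c x ≫ I.cocomplex.d n (n + 1) = 0 ↔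
      x ∈ LinearMap.ker (primComplex I n c).g.hom := by
  have h : ∀ x : ((H0 k).obj (I.cocomplex.X n)).obj (op ⟨c.carrier⟩),
      primitivesEquivHom _ c x ≫ I.cocomplex.d n (n + 1) = 0 ↔
      (((H0 k).map (I.cocomplex.d n (n + 1))).app (op ⟨c.carrier⟩)).hom x = 0 := fun x => by
    rw [← primitivesEquivHom_map, LinearEquiv.map_eq_zero_iff]
  exact h x

/-- The map from cocycles of primitive elements to `Ext`. -/
def cocycleToExt : LinearMap.ker (primComplex I n c).g.hom →ₗ[k] H n c F where
  toFun x := I.extMk (primComplexHom I n c x.1) (n + 1) rfl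
    ((primComplexHom_d_eq_zero_iff I n c x.1).2 x.2)
  map_add' x y := by
    rw [I.add_extMk]
    congr 1
    exact map_add (primComplexHom I n c) x.1 y.1
  map_smul' r x := by
    rw [RingHom.id_apply, ← I.extMk_smul]
    congr 1
    exact map_smul (primComplexHom I n c) r x.1

lemma cocycleToExt_apply (x : LinearMap.ker (primComplex I n c).g.hom) :
    cocycleToExt I n c x = I.extMk (primComplexHom I n c x.1) (n + 1) rfl
      ((primComplexHom_d_eq_zero_iff I n c x.1).2 x.2) := rfl

lemma cocycleToExt_surjective : Function.Surjective (cocycleToExt I n c) := by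
  intro e
  obtain ⟨f, hf, rfl⟩ := I.extMk_surjective e (n + 1) rfl
  obtain ⟨x, rfl⟩ := (primComplexHom I n c).surjective f
  exact ⟨⟨x, (primComplexHom_d_eq_zero_iff I n c x).1 hf⟩, rfl⟩

/-- An Ext class vanishes exactly when its cocycle is a coboundary, so homology of primitives and
`Ext` are the same quotient of the same cocycles. -/
lemma range_moduleCatToCycles_primComplex :
    LinearMap.range (primComplex I n c).moduleCatToCycles = LinearMap.ker (cocycleToExt I n c) := by
  ext x
  rw [LinearMap.mem_ker, LinearMap.mem_range, cocycleToExt_apply]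
  cases n with
  | zero =>
    rw [I.extMk_zero_eq_zero_iff, LinearEquiv.map_eq_zero_iff]
    -- The predecessor of `0` in this complex shape is `0` itself, and the differential from `0` to
    -- `0` is zero.
    have h0 : (primComplex I 0 c).f = 0 := by
      have : (((H0 k).mapHomologicalComplex (ComplexShape.up ℕ)).obj I.cocomplex).d
          ((ComplexShape.up ℕ).prev 0) 0 = 0 := HomologicalComplex.shape _ _ _ (by simp)
      exact congrArg (fun t => t.app (op ⟨c.carrier⟩)) this
    constructor
    · rintro ⟨y, rfl⟩
      exact congrArg (fun t => t.hom y) h0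
    · intro hx
      exact ⟨0, (map_zero _).trans (Subtype.ext hx.symm)⟩
  | succ n =>
    rw [I.extMk_eq_zero_iff _ _ _ _ n rfl]
    -- The index is generalised because the predecessor of `n + 1` is only propositionally equal to
    -- `n`.
    have key : ∀ (m : ℕ), m = n → ((∃ y : (((H0 k).obj (I.cocomplex.X m)).obj (op ⟨c.carrier⟩)),
        (((H0 k).map (I.cocomplex.d m (n + 1))).app (op ⟨c.carrier⟩)).hom y = x.1) ↔
        ∃ g, g ≫ I.cocomplex.d n (n + 1) = primComplexHom I (n + 1) c x.1) := by
      rintro m rfl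
      constructor
      · rintro ⟨y, hy⟩
        refine ⟨primitivesEquivHom _ c y, ?_⟩
        rw [← primitivesEquivHom_map]
        exact congrArg (primComplexHom I (m + 1) c) hy
      · rintro ⟨g, hg⟩
        obtain ⟨y, rfl⟩ := (primitivesEquivHom _ c).surjective g
        refine ⟨y, ?_⟩
        rw [← primitivesEquivHom_map] at hg
        exact (primComplexHom I (m + 1) c).injective hg
    rw [← key _ (CochainComplex.prev_nat_succ n)]
    exact ⟨fun ⟨y, hy⟩ => ⟨y, congrArg Subtype.val hy⟩, fun ⟨y, hy⟩ => ⟨y, Subtype.ext hy⟩⟩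

/-- Cohomology is `Ext` out of the module representing primitives. -/
def cohomologyEquiv (F : FIopMod k) (n : ℕ) (c : FI) :
    ((cohomology k n).obj F).obj (op ⟨c.carrier⟩) ≃ₗ[k] H n c F :=
  let I := injectiveResolution F
  (((evaluation _ _).obj (op ⟨c.carrier⟩)).mapIso (I.isoRightDerivedObj (H0 k) n ≪≫
    HomologicalComplex.homologyIsoSc' _ _ n (n + 1) rfl (by simp)) ≪≫
    -- Evaluation at `c` is exact, so homology may be taken after evaluating.
    (ShortComplex.mapHomologyIso _ _).symm ≪≫
    (primComplex I n c).moduleCatHomologyIso).toLinearEquiv.trans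
  ((Submodule.quotEquivOfEq _ _ (range_moduleCatToCycles_primComplex I n c)).trans
    ((cocycleToExt I n c).quotKerEquivOfSurjective (cocycleToExt_surjective I n c)))

end cohomologyEquiv

/-! ## The long exact sequence -/

/-- The map on `Ext` induced by a morphism. -/
def hmap {F G : FIopMod k} (φ : F ⟶ G) (n : ℕ) (c : FI) : H n c F →ₗ[k] H n c G :=
  (Ext.mk₀ φ).postcompOfLinear k _ (add_zero n)

lemma hmap_hmap {F G K : FIopMod k} (φ : F ⟶ G) (ψ : G ⟶ K) (n : ℕ) (c : FI) (x : H n c F) :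
    hmap ψ n c (hmap φ n c x) = hmap (φ ≫ ψ) n c x := by
  refine (Ext.comp_assoc_of_third_deg_zero x (Ext.mk₀ φ) (Ext.mk₀ ψ) (add_zero n)).trans ?_
  rw [Ext.mk₀_comp_mk₀]
  rfl

lemma hmap_id (F : FIopMod k) (n : ℕ) (c : FI) (x : H n c F) : hmap (𝟙 F) n c x = x :=
  Ext.comp_mk₀_id x

lemma hmap_zero (F G : FIopMod k) (n : ℕ) (c : FI) (x : H n c F) :
    hmap (0 : F ⟶ G) n c x = 0 := by
  change x.comp (Ext.mk₀ 0) (add_zero n) = 0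
  rw [Ext.mk₀_zero, Ext.comp_zero]

lemma hmap_sum {ι : Type} (s : Finset ι) {F G : FIopMod k} (φ : ι → (F ⟶ G)) (n : ℕ) (c : FI)
    (x : H n c F) : hmap (∑ j ∈ s, φ j) n c x = ∑ j ∈ s, hmap (φ j) n c x := by
  classical
  induction s using Finset.induction_on with
  | empty => exact hmap_zero F G n c x
  | insert j s hj ih =>
    rw [Finset.sum_insert hj, Finset.sum_insert hj, ← ih]
    refine Eq.trans ?_ (Ext.comp_add _ _ _ (add_zero n))
    rw [← Ext.mk₀_add]
    rfl

/-- The connecting map on `Ext`. -/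
def hdelta {S : ShortComplex (FIopMod k)} (hS : S.ShortExact) (n : ℕ) (c : FI) :
    H n c S.X₃ →ₗ[k] H (n + 1) c S.X₁ :=
  hS.extClass.postcompOfLinear k _ rfl

section LES

variable {S : ShortComplex (FIopMod k)} (hS : S.ShortExact) (n : ℕ) (c : FI)

include hS in
lemma exact_hmap_hmap : Function.Exact (hmap S.f n c) (hmap S.g n c) := by
  intro x
  refine ⟨fun h => Ext.covariant_sequence_exact₂ _ hS x h, ?_⟩
  rintro ⟨y, rfl⟩
  rw [hmap_hmap, S.zero, hmap_zero]

lemma exact_hmap_hdelta : Function.Exact (hmap S.g n c) (hdelta hS n c) := by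
  intro x
  refine ⟨fun h => Ext.covariant_sequence_exact₃ _ hS x rfl h, ?_⟩
  rintro ⟨y, rfl⟩
  change (y.comp (Ext.mk₀ S.g) (add_zero n)).comp hS.extClass rfl = 0
  rw [Ext.comp_assoc_of_second_deg_zero, ShortComplex.ShortExact.comp_extClass, Ext.comp_zero]

lemma exact_hdelta_hmap : Function.Exact (hdelta hS n c) (hmap S.f (n + 1) c) := by
  intro x
  refine ⟨fun h => Ext.covariant_sequence_exact₁ _ hS x h rfl, ?_⟩
  rintro ⟨y, rfl⟩
  change (y.comp hS.extClass rfl).comp (Ext.mk₀ S.f) (add_zero (n + 1)) = 0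
  rw [Ext.comp_assoc_of_third_deg_zero, ShortComplex.ShortExact.extClass_comp, Ext.comp_zero]

lemma hmap_zero_injective {F G : FIopMod k} (φ : F ⟶ G) [Mono φ] :
    Function.Injective (hmap φ 0 c) := by
  intro x y h
  exact Ext.postcomp_mk₀_injective_of_mono _ φ h

/-- The connecting map is an isomorphism if the cohomology of the middle term vanishes. -/
def hdeltaEquiv [Subsingleton (H n c S.X₂)] [Subsingleton (H (n + 1) c S.X₂)] :
    H n c S.X₃ ≃ₗ[k] H (n + 1) c S.X₁ :=
  LinearEquiv.ofBijective (hdelta hS n c) (by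
    constructor
    · rw [← LinearMap.ker_eq_bot, LinearMap.ker_eq_bot']
      intro x hx
      obtain ⟨y, rfl⟩ := (exact_hmap_hdelta hS n c x).1 hx
      rw [Subsingleton.elim y 0, map_zero]
    · intro x
      exact (exact_hdelta_hmap hS n c x).1 (Subsingleton.elim _ _))

/-- The linear equivalence on `Ext` induced by an isomorphism of coefficients. -/
def hmapIso {F G : FIopMod k} (e : F ≅ G) : H n c F ≃ₗ[k] H n c G :=
  LinearEquiv.ofLinearMap (hmap e.hom n c) (hmap e.inv n c)
    (LinearMap.ext fun x => by
      rw [LinearMap.comp_apply, hmap_hmap, e.inv_hom_id, hmap_id, LinearMap.id_apply])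
    (LinearMap.ext fun x => by
      rw [LinearMap.comp_apply, hmap_hmap, e.hom_inv_id, hmap_id, LinearMap.id_apply])

end LES

instance subsingleton_H_injective (n : ℕ) (c : FI) (I : FIopMod k) [Injective I] :
    Subsingleton (H (n + 1) c I) := Ext.subsingleton_of_injective _ _ n

/-- Two quotients are isomorphic if they have the same kernels. -/
lemma nonempty_linearEquiv_of_surjective {M M' N N' : Type*} [AddCommGroup M] [AddCommGroup M']
    [AddCommGroup N] [AddCommGroup N'] [Module k M] [Module k M'] [Module k N] [Module k N']
    (f : M →ₗ[k] N) (f' : M' →ₗ[k] N') (hf : Function.Surjective f) (hf' : Function.Surjective f')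
    (e : M ≃ₗ[k] M') (h : ∀ x, f x = 0 ↔ f' (e x) = 0) : Nonempty (N ≃ₗ[k] N') := by
  refine ⟨(f.quotKerEquivOfSurjective hf).symm.trans
    ((Submodule.Quotient.equiv _ _ e ?_).trans (f'.quotKerEquivOfSurjective hf'))⟩
  ext y
  obtain ⟨x, rfl⟩ := e.surjective y
  rw [LinearMap.mem_ker, ← h, Submodule.mem_map]
  constructor
  · rintro ⟨x', hx', hxx'⟩
    rwa [← e.injective hxx']
  · intro hx
    exact ⟨x, hx, rfl⟩

/-! ### Cohomology and the difference module -/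

/-- In degree zero, `Ext` at `c ⊔ {*}` is `Ext` at `c` of the difference module. -/
def hzeroOptEquiv (F : FIopMod k) (c : FI) : H 0 c.opt F ≃ₗ[k] H 0 c (diff F) :=
  Ext.linearEquiv₀.trans ((bijModOptHomEquiv F c).trans Ext.linearEquiv₀.symm)

lemma hzeroOptEquiv_hmap {F G : FIopMod k} (φ : F ⟶ G) (c : FI) (x : H 0 c.opt F) :
    hzeroOptEquiv G c (hmap φ 0 c.opt x) = hmap (diffMap φ) 0 c (hzeroOptEquiv F c x) := by
  obtain ⟨f, rfl⟩ := (Ext.linearEquiv₀ (R := k)).symm.surjective x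
  have h : hmap φ 0 c.opt (Ext.linearEquiv₀ (R := k).symm f) =
      Ext.linearEquiv₀ (R := k).symm (f ≫ φ) := Ext.mk₀_comp_mk₀ _ _
  have h' : ∀ g : bijMod k c ⟶ diff F, hmap (diffMap φ) 0 c (Ext.linearEquiv₀ (R := k).symm g) =
      Ext.linearEquiv₀ (R := k).symm (g ≫ diffMap φ) := fun g => Ext.mk₀_comp_mk₀ _ _
  rw [h]
  simp only [hzeroOptEquiv, LinearEquiv.trans_apply, LinearEquiv.apply_symm_apply]
  rw [h', bijModOptHomEquiv_comp]

/-- Dimension shifting along an embedding into an injective: `diff` keeps the sequence exact and the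
middle term injective, and the cokernel again has surjective restrictions, being a quotient of an
injective. -/
lemma nonempty_H_opt_equiv (n : ℕ) (c : FI) (F : FIopMod k) (hF : IncSurjective F) :
    Nonempty (H n c.opt F ≃ₗ[k] H n c (diff F)) := by
  induction n generalizing F with
  | zero => exact ⟨hzeroOptEquiv F c⟩
  | succ n ih =>
    let S : ShortComplex (FIopMod k) := ShortComplex.mk (Injective.ι F)
      (cokernel.π (Injective.ι F)) (cokernel.condition _)
    have hS : S.ShortExact := { exact := ShortComplex.exact_cokernel _ }
    have hS' := diffShortComplex_shortExact hS hF
    have h1 : ∀ m, Subsingleton (H (m + 1) c.opt S.X₂) := fun m =>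
      subsingleton_H_injective m c.opt (Injective.under F)
    have h2 : ∀ m, Subsingleton (H (m + 1) c (diffShortComplex S).X₂) := fun m =>
      subsingleton_H_injective m c (diff (Injective.under F))
    have hC : IncSurjective S.X₃ :=
      (incSurjective_of_injective (Injective.under F)).of_epi S.g
    cases n with
    | zero =>
      -- An injective may have nonzero `H^0`, so the connecting map is only surjective here. Both
      -- groups `H^1` are cokernels of maps on `H^0` that correspond under `hzeroOptEquiv`.
      refine nonempty_linearEquiv_of_surjective (hdelta hS 0 c.opt) (hdelta hS' 0 c)
        (fun x => (exact_hdelta_hmap hS 0 c.opt x).1 ((h1 0).elim _ _))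
        (fun x => (exact_hdelta_hmap hS' 0 c x).1 ((h2 0).elim _ _))
        (hzeroOptEquiv S.X₃ c) fun x => ?_
      rw [exact_hmap_hdelta hS 0 c.opt x, exact_hmap_hdelta hS' 0 c]
      constructor
      · rintro ⟨y, rfl⟩
        exact ⟨hzeroOptEquiv S.X₂ c y, (hzeroOptEquiv_hmap S.g c y).symm⟩
      · rintro ⟨y, hy⟩
        obtain ⟨z, rfl⟩ := (hzeroOptEquiv S.X₂ c).surjective y
        refine ⟨z, (hzeroOptEquiv S.X₃ c).injective ?_⟩
        rw [hzeroOptEquiv_hmap]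
        exact hy
    | succ n =>
      obtain ⟨e⟩ := ih S.X₃ hC
      have := h1 n
      have := h1 (n + 1)
      have := h2 n
      have := h2 (n + 1)
      exact ⟨(hdeltaEquiv hS (n + 1) c.opt).symm.trans (e.trans (hdeltaEquiv hS' (n + 1) c))⟩

/-! ### Cohomology at the empty set -/

/-- The condition is vacuous: every map into the empty set is surjective. -/
lemma mem_prim_of_isEmpty (F : FIopMod k) (c : FI) [IsEmpty c.carrier] (x : F.obj (op c)) :
    x ∈ prim F c := fun _ _ hi => absurd (fun y => isEmptyElim y) hi

/-- At the empty set primitives are all elements, so this module represents evaluation, which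
preserves epimorphisms. -/
instance projective_bijMod (c : FI) [IsEmpty c.carrier] : Projective (bijMod k c) where
  factors {F G} φ π _ := by
    obtain ⟨x, hx⟩ := (epi_iff π).1 inferInstance c (comp φ c (bijModId k c))
    refine ⟨(bijModHomEquiv F c).symm ⟨x, mem_prim_of_isEmpty F c x⟩, ?_⟩
    apply (bijModHomEquiv G c).injective
    ext1
    rw [bijModHomEquiv_comp, LinearEquiv.apply_symm_apply, hx]
    rfl

instance subsingleton_H_of_isEmpty (n : ℕ) (c : FI) [IsEmpty c.carrier] (F : FIopMod k) :
    Subsingleton (H (n + 1) c F) := Ext.subsingleton_of_projective _ _ n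

/-- In degree zero, `Ext` at the empty set is the value at the empty set. -/
def hzeroEmptyEquiv (F : FIopMod k) (c : FI) [IsEmpty c.carrier] :
    H 0 c F ≃ₗ[k] F.obj (op c) :=
  Ext.linearEquiv₀.trans ((bijModHomEquiv F c).trans
    (LinearEquiv.ofTop _ (eq_top_iff.2 fun x _ => mem_prim_of_isEmpty F c x)))

/-- In degree zero, `Ext` is primitive elements. -/
def hzeroEquiv (F : FIopMod k) (c : FI) : H 0 c F ≃ₗ[k] prim F c :=
  Ext.linearEquiv₀.trans (bijModHomEquiv F c)

/-! ### Finite products -/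

/-- The product of a family of `FI^op`-modules. -/
def piMod {ι : Type} (F : ι → FIopMod k) : FIopMod k where
  obj c := ModuleCat.of k (∀ j, (F j).obj c)
  map i := ModuleCat.ofHom
    (LinearMap.pi fun j => ((F j).map i).hom.comp (LinearMap.proj j))
  map_id c := by
    ext v j
    exact res_id (F j) c.unop (v j)
  map_comp i i' := by
    ext v j
    exact res_comp (F j) i.unop i'.unop (v j)

/-- The projections from a product of `FI^op`-modules. -/
def piModProj {ι : Type} (F : ι → FIopMod k) (j : ι) : piMod F ⟶ F j :=
  mkHom (fun c => LinearMap.proj (R := k) (φ := fun j => (F j).obj (op c)) j) fun _ _ => rfl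

lemma piMod_ext {ι : Type} {F : ι → FIopMod k} {c : FI} {x y : (piMod F).obj (op c)}
    (h : ∀ j, comp (piModProj F j) c x = comp (piModProj F j) c y) : x = y := funext h

/-- The morphism to a product given by its components. -/
def piModLift {ι : Type} {F : ι → FIopMod k} {G : FIopMod k} (φ : ∀ j, G ⟶ F j) : G ⟶ piMod F :=
  mkHom (fun c => LinearMap.pi fun j => comp (φ j) c)
    fun i x => piMod_ext fun j => comp_res (φ j) i x

lemma piModLift_proj {ι : Type} {F : ι → FIopMod k} {G : FIopMod k} (φ : ∀ j, G ⟶ F j) (j : ι) :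
    piModLift φ ≫ piModProj F j = φ j := rfl

open Classical in
/-- `Ext` into a finite product. -/
def hpiEquiv {ι : Type} [Fintype ι] (F : ι → FIopMod k) (n : ℕ) (c : FI) :
    H n c (piMod F) ≃ₗ[k] ∀ j, H n c (F j) :=
  let inc : ∀ j, F j ⟶ piMod F := fun j =>
    piModLift fun j' => if h : j = j' then eqToHom (congrArg F h) else 0
  have hinc : ∀ j, inc j ≫ piModProj F j = 𝟙 _ := fun j => by
    simp [inc, piModLift_proj]
  have hinc' : ∀ j j', j ≠ j' → inc j ≫ piModProj F j' = 0 := fun j j' h => by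
    simp [inc, piModLift_proj, h]
  have hsum : ∑ j, piModProj F j ≫ inc j = 𝟙 (piMod F) := by
    have h : ∀ j', (∑ j, piModProj F j ≫ inc j) ≫ piModProj F j' = 𝟙 (piMod F) ≫ piModProj F j' :=
      fun j' => by
        rw [Preadditive.sum_comp, Finset.sum_eq_single j', Category.assoc, hinc,
          Category.comp_id, Category.id_comp]
        · intro j _ hj
          rw [Category.assoc, hinc' j j' hj, comp_zero]
        · simp
    exact FIop.hom_ext fun c x => piMod_ext fun j => congrArg (fun φ => comp φ c x) (h j)
  LinearEquiv.ofLinearMap (LinearMap.pi fun j => hmap (piModProj F j) n c)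
    (∑ j, (hmap (inc j) n c).comp (LinearMap.proj j))
    (by
      refine LinearMap.ext fun x => funext fun j' => ?_
      simp only [LinearMap.comp_apply, LinearMap.sum_apply, LinearMap.pi_apply, map_sum,
        LinearMap.proj_apply, hmap_hmap, LinearMap.id_apply]
      rw [Finset.sum_eq_single j']
      · rw [hinc, hmap_id]
      · intro j _ hj
        rw [hinc' j j' hj, hmap_zero]
      · simp)
    (by
      refine LinearMap.ext fun x => ?_
      simp only [LinearMap.comp_apply, LinearMap.sum_apply, LinearMap.pi_apply,
        LinearMap.proj_apply, hmap_hmap, LinearMap.id_apply]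
      rw [← hmap_sum, hsum, hmap_id])


/-! ## Modules of maps with prescribed image -/

/-! ### Linear maps induced by partial maps of bases -/

section pmap

variable {X Y Z : Type}

lemma pmap_apply_of_unique (ψ : Y → Option Z) (y : Y) (z : Z) (h : ψ y = some z)
    (hu : ∀ y', ψ y' = some z → y' = y) (v : Y →₀ k) : pmap k ψ v z = v y := by
  suffices H : (Finsupp.lapply z).comp (pmap k ψ) = (Finsupp.lapply y : (Y →₀ k) →ₗ[k] k) from
    LinearMap.congr_fun H v
  classical
  refine linearMap_ext fun y' => ?_
  simp only [LinearMap.comp_apply, pmap_single, Finsupp.lapply_apply]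
  by_cases hy : y' = y
  · subst hy
    simp [h]
  · rw [Finsupp.single_eq_of_ne' hy]
    cases hz : ψ y' with
    | none => rfl
    | some z' =>
      rw [gen_some, Finsupp.single_eq_of_ne' fun hzz => hy (hu y' (by rw [hz, hzz]))]

lemma pmap_surjective (ψ : Y → Option Z) (h : ∀ z, ∃ y, ψ y = some z) :
    Function.Surjective (pmap k ψ) := by
  intro w
  induction w using Finsupp.induction_linear with
  | zero => exact ⟨0, map_zero _⟩
  | add w₁ w₂ h₁ h₂ =>
    obtain ⟨v₁, rfl⟩ := h₁
    obtain ⟨v₂, rfl⟩ := h₂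
    exact ⟨v₁ + v₂, map_add _ _ _⟩
  | single z r =>
    obtain ⟨y, hy⟩ := h z
    refine ⟨r • Finsupp.single y 1, ?_⟩
    rw [map_smul, pmap_single, hy, gen_some, Finsupp.smul_single, smul_eq_mul, mul_one]

/-- Where `ψ` is defined and injective, the coefficients of a kernel element can be read off the
image and vanish. What remains is supported where `ψ` is undefined, and `φ` reaches all those basis
elements. -/
lemma mem_range_pmap (φ : X → Option Y) (ψ : Y → Option Z)
    (hψ : ∀ y y' z, ψ y = some z → ψ y' = some z → y = y')
    (h : ∀ y, ψ y = none → ∃ x, φ x = some y) (v : Y →₀ k) (hv : pmap k ψ v = 0) :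
    ∃ w, pmap k φ w = v := by
  change v ∈ LinearMap.range (pmap k φ)
  rw [← Finsupp.sum_single v]
  refine Submodule.sum_mem _ fun y _ => ?_
  cases hy : ψ y with
  | none =>
    obtain ⟨x, hx⟩ := h y hy
    refine ⟨v y • Finsupp.single x 1, ?_⟩
    rw [map_smul, pmap_single, hx, gen_some, Finsupp.smul_single, smul_eq_mul, mul_one]
  | some z =>
    have h1 := pmap_apply_of_unique (k := k) ψ y z hy (fun y' hy' => hψ y' y z hy' hy) v
    rw [hv] at h1
    rw [← h1, Finsupp.zero_apply, Finsupp.single_zero]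
    exact Submodule.zero_mem _

end pmap

/-- A map takes all values in `P` and only values in `R`. -/
def Hits (P R : Finset ℕ) (X : Type) (f : X → ℕ) : Prop :=
  (∀ a ∈ P, ∃ x, f x = a) ∧ ∀ x, f x ∈ R

lemma admissible_hits (P R : Finset ℕ) : Admissible (Hits P R) := by
  intro X Y Z f i j _ hf h
  exact ⟨fun a ha => (h.1 a ha).imp' j fun _ hx => hx, fun x => hf.2 _⟩

/-- The maps which take all values in `P` and only values in `R`. -/
abbrev hitPresheaf (P R : Finset ℕ) : PartialPresheaf :=
  mapsPresheaf (Hits P R) (admissible_hits P R)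

/-- The `FI^op`-module with basis the maps which take all values in `P` and only values in `R`. -/
abbrev hitMod (k : Type u) [CommRing k] (P R : Finset ℕ) : FIopMod k :=
  freeMod k (hitPresheaf P R)

open Classical in
/-- The partial map between sets of maps with different conditions on the image. -/
def hitFun {P R : Finset ℕ} (P' R' : Finset ℕ) (c : FI) (f : (hitPresheaf P R).obj c) :
    Option ((hitPresheaf P' R').obj c) :=
  if h : Hits P' R' c.carrier f.1 then some ⟨f.1, h⟩ else none

lemma hitFun_pos {P R P' R' : Finset ℕ} {c : FI} {f : (hitPresheaf P R).obj c}
    (h : Hits P' R' c.carrier f.1) : hitFun P' R' c f = some ⟨f.1, h⟩ := dif_pos h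

lemma hitFun_neg {P R P' R' : Finset ℕ} {c : FI} {f : (hitPresheaf P R).obj c}
    (h : ¬ Hits P' R' c.carrier f.1) : hitFun P' R' c f = none := dif_neg h

/-- Both composites are the restricted map when it satisfies the stricter lower condition and are
undefined otherwise; any map with such a restriction already satisfies the conditions along the way.
-/
lemma hitFun_natural {P R P' R' : Finset ℕ} (hP : P ⊆ P') (hR : R ⊆ R') {c d : FI} (i : d ⟶ c)
    (f : (hitPresheaf P R).obj c) :
    (hitFun P' R' c f).bind ((hitPresheaf P' R').res i) =
      ((hitPresheaf P R).res i f).bind (hitFun P' R' d) := by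
  have hr : ∀ x, f.1 (FI.fn i x) ∈ R := fun x => f.2.2 _
  by_cases h : Hits P' R' d.carrier (f.1 ∘ FI.fn i)
  · have h1 : Hits P' R' c.carrier f.1 :=
      ⟨fun a ha => (h.1 a ha).imp' (FI.fn i) fun _ hx => hx, fun x => hR (f.2.2 x)⟩
    have h2 : Hits P R d.carrier (f.1 ∘ FI.fn i) := ⟨fun a ha => h.1 a (hP ha), hr⟩
    rw [hitFun_pos h1, Option.bind_some, mapsPresheaf_res_pos (admissible_hits _ _) i _ h2,
      Option.bind_some, mapsPresheaf_res_pos (admissible_hits _ _) i _ h]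
    exact (hitFun_pos (f := ⟨f.1 ∘ FI.fn i, h2⟩) h).symm
  · have h1 : ((hitPresheaf P R).res i f).bind (hitFun P' R' d) = none := by
      by_cases h2 : Hits P R d.carrier (f.1 ∘ FI.fn i)
      · rw [mapsPresheaf_res_pos (admissible_hits _ _) i _ h2, Option.bind_some]
        exact hitFun_neg (f := ⟨f.1 ∘ FI.fn i, h2⟩) h
      · rw [mapsPresheaf_res_neg (admissible_hits _ _) i _ h2, Option.bind_none]
    rw [h1]
    by_cases h3 : Hits P' R' c.carrier f.1
    · rw [hitFun_pos h3, Option.bind_some]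
      exact mapsPresheaf_res_neg (admissible_hits _ _) i ⟨f.1, h3⟩ h
    · rw [hitFun_neg h3, Option.bind_none]

/-- The morphism between modules of maps with different conditions on the image. -/
def hitMap (k : Type u) [CommRing k] {P R P' R' : Finset ℕ} (hP : P ⊆ P') (hR : R ⊆ R') :
    hitMod k P R ⟶ hitMod k P' R' :=
  freeMap k (hitFun P' R') fun i f => hitFun_natural hP hR i f

lemma comp_hitMap {P R P' R' : Finset ℕ} (hP : P ⊆ P') (hR : R ⊆ R') (c : FI) :
    comp (hitMap k hP hR) c = pmap k (hitFun P' R' c) := rfl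

lemma hitFun_eq_some_iff {P R P' R' : Finset ℕ} {c : FI} {f : (hitPresheaf P R).obj c}
    {g : (hitPresheaf P' R').obj c} : hitFun P' R' c f = some g ↔ f.1 = g.1 := by
  constructor
  · intro h
    by_cases hf : Hits P' R' c.carrier f.1
    · rw [hitFun_pos hf] at h
      exact congrArg Subtype.val (Option.some_injective _ h)
    · rw [hitFun_neg hf] at h
      cases h
  · intro h
    have hf : Hits P' R' c.carrier f.1 := by rw [h]; exact g.2
    rw [hitFun_pos hf]
    exact congrArg some (Subtype.ext h)

lemma hitFun_eq_none_iff {P R P' R' : Finset ℕ} {c : FI} {f : (hitPresheaf P R).obj c} :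
    hitFun P' R' c f = none ↔ ¬ Hits P' R' c.carrier f.1 := by
  by_cases hf : Hits P' R' c.carrier f.1
  · simp [hitFun_pos hf, hf]
  · simp [hitFun_neg hf, hf]

lemma hitMap_surjective {P P' R : Finset ℕ} (hP : P ⊆ P') (c : FI) :
    Function.Surjective (comp (hitMap k hP (Finset.Subset.refl R)) c) :=
  pmap_surjective _ fun g => ⟨⟨g.1, fun a ha => g.2.1 a (hP ha), g.2.2⟩,
    hitFun_eq_some_iff.2 rfl⟩

lemma hitMap_injective {P P' R R' : Finset ℕ} (hP : P ⊆ P') (hR : R ⊆ R') (hP' : P' ⊆ P) (c : FI) :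
    Function.Injective (comp (hitMap k hP hR) c) := by
  rw [comp_hitMap]
  have h : hitFun P' R' c = fun f : (hitPresheaf P R).obj c =>
      some (⟨f.1, fun a ha => f.2.1 a (hP' ha), fun x => hR (f.2.2 x)⟩ :
        (hitPresheaf P' R').obj c) :=
    funext fun f => hitFun_eq_some_iff.2 rfl
  rw [h]
  exact pmap_some_injective _ fun f g hfg =>
    Subtype.ext (congrArg (fun t : (hitPresheaf P' R').obj c => t.1) hfg)

/-- A map with values in `R'` that fails to hit all of `P'` must miss `j`, so its values lie in `R`.
Containments in `insert j` allow use both when a value is added and when one is erased. -/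
lemma hitMap_exact {P P' R R' : Finset ℕ} {j : ℕ} (hP : P ⊆ P') (hR : R ⊆ R')
    (hP' : P' ⊆ insert j P) (hR' : R' ⊆ insert j R) (c : FI) (v : (hitMod k P R').obj (op c))
    (hv : comp (hitMap k hP (Finset.Subset.refl R')) c v = 0) :
    ∃ w, comp (hitMap k (Finset.Subset.refl P) hR) c w = v := by
  refine mem_range_pmap (hitFun P R' c) (hitFun P' R' c)
    (fun f g z hf hg => Subtype.ext ?_) (fun f hf => ?_) v hv
  · rw [hitFun_eq_some_iff] at hf hg
    rw [hf, hg]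
  · rw [hitFun_eq_none_iff] at hf
    refine ⟨⟨f.1, f.2.1, fun x => ?_⟩, hitFun_eq_some_iff.2 rfl⟩
    rcases Finset.mem_insert.1 (hR' (f.2.2 x)) with hx | hx
    · refine absurd ⟨fun a ha => ?_, f.2.2⟩ hf
      rcases Finset.mem_insert.1 (hP' ha) with rfl | ha
      · exact ⟨x, hx⟩
      · exact f.2.1 a ha
    · exact hx

lemma hitMap_hitMap_eq_zero {P P' R R' : Finset ℕ} {j : ℕ} (hP : P ⊆ P') (hR : R ⊆ R')
    (hjP : j ∈ P') (hjR : j ∉ R) :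
    hitMap k (Finset.Subset.refl P) hR ≫ hitMap k hP (Finset.Subset.refl R') = 0 := by
  refine freeMod_hom_ext fun c f => ?_
  have h : pmap k (hitFun P' R' c) (pmap k (hitFun P R' c) (Finsupp.single f 1)) = 0 := by
    rw [pmap_single, pmap_gen]
    have h1 : hitFun P R' c f = some (⟨f.1, f.2.1, fun x => hR (f.2.2 x)⟩ :
        (hitPresheaf P R').obj c) :=
      hitFun_eq_some_iff.2 rfl
    rw [h1, Option.bind_some, hitFun_eq_none_iff.2, gen_none]
    intro H
    obtain ⟨x, hx⟩ := H.1 j hjP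
    exact hjR (hx ▸ f.2.2 x)
  exact h

/-- The short complex which separates the maps according to whether they take the value `j`. -/
abbrev hitShortComplex (k : Type u) [CommRing k] (P : Finset ℕ) {R : Finset ℕ} {j : ℕ}
    (hj : j ∉ R) : ShortComplex (FIopMod k) :=
  ShortComplex.mk (hitMap k (Finset.Subset.refl P) (Finset.subset_insert j R))
    (hitMap k (Finset.subset_insert j P) (Finset.Subset.refl (insert j R)))
    (hitMap_hitMap_eq_zero _ _ (Finset.mem_insert_self j P) hj)

/-- For `R = P` this relates surjections onto `P` and onto `insert j P`, with an acyclic middle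
term. -/
lemma hitShortComplex_shortExact (P : Finset ℕ) {R : Finset ℕ} {j : ℕ} (hj : j ∉ R) :
    (hitShortComplex k P hj).ShortExact :=
  shortExact_of_app (hitMap_injective (Finset.Subset.refl P) (Finset.subset_insert j R)
      (Finset.Subset.refl P))
    (hitMap_surjective (Finset.subset_insert j P))
    (hitMap_exact (Finset.subset_insert j P) (Finset.subset_insert j R) (Finset.Subset.refl _)
      (Finset.Subset.refl _))

/-! ### The difference modules -/

open Classical in
/-- The restriction of a map with value `j` at the added point, as a partial map. -/
def hitSplit {P R : Finset ℕ} (j : ℕ) (c : FI) (f : (hitPresheaf P R).obj c.opt) :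
    Option ((hitPresheaf (P.erase j) R).obj c) :=
  if h : f.1 none = j then some ⟨fun x => f.1 (some x), fun a ha => by
    obtain ⟨x, hx⟩ := f.2.1 a (Finset.mem_of_mem_erase ha)
    cases x with
    | none => exact absurd (hx.symm.trans h) (Finset.ne_of_mem_erase ha)
    | some x => exact ⟨x, hx⟩, fun x => f.2.2 _⟩ else none

/-- The extension of a map by the value `j` at the added point. -/
def hitExtend {P R : Finset ℕ} {j : ℕ} (hj : j ∈ R) (c : FI)
    (f : (hitPresheaf (P.erase j) R).obj c) : (hitPresheaf P R).obj c.opt :=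
  ⟨fun x => x.elim j f.1, fun a ha => by
    by_cases h : a = j
    · exact ⟨none, h.symm⟩
    · obtain ⟨x, hx⟩ := f.2.1 a (Finset.mem_erase_of_ne_of_mem h ha)
      exact ⟨some x, hx⟩, fun x => by
    cases x with
    | none => exact hj
    | some x => exact f.2.2 x⟩

lemma hitSplit_hitExtend_self {P R : Finset ℕ} {j : ℕ} (hj : j ∈ R) (c : FI)
    (f : (hitPresheaf (P.erase j) R).obj c) : hitSplit j c (hitExtend hj c f) = some f :=
  dif_pos rfl

lemma hitSplit_hitExtend_of_ne {P R : Finset ℕ} {j j' : ℕ} (hj : j ∈ R) (h : j ≠ j') (c : FI)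
    (f : (hitPresheaf (P.erase j) R).obj c) : hitSplit j' c (hitExtend hj c f) = none :=
  dif_neg h

lemma exists_hitExtend {P R : Finset ℕ} (c : FI) (f : (hitPresheaf P R).obj c.opt) :
    ∃ (j : ℕ) (hj : j ∈ R) (g : (hitPresheaf (P.erase j) R).obj c), hitExtend hj c g = f := by
  refine ⟨f.1 none, f.2.2 none, ⟨fun x => f.1 (some x), fun a ha => ?_, fun x => f.2.2 _⟩,
    Subtype.ext (funext fun x => by cases x <;> rfl)⟩
  obtain ⟨x, hx⟩ := f.2.1 a (Finset.mem_of_mem_erase ha)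
  cases x with
  | none => exact absurd hx.symm (Finset.ne_of_mem_erase ha)
  | some x => exact ⟨x, hx⟩

lemma hitExtend_natural {P R : Finset ℕ} {j : ℕ} (hj : j ∈ R) {c d : FI} (i : d ⟶ c)
    (f : (hitPresheaf (P.erase j) R).obj c) :
    (hitPresheaf P R).res (FI.optMap i) (hitExtend hj c f) =
      ((hitPresheaf (P.erase j) R).res i f).map (hitExtend hj d) := by
  have hcomp : (hitExtend hj c f).1 ∘ FI.fn (FI.optMap i) =
      fun x => x.elim j (f.1 ∘ FI.fn i) := funext fun x => by cases x <;> rfl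
  by_cases h : Hits (P.erase j) R d.carrier (f.1 ∘ FI.fn i)
  · have h1 : Hits P R d.opt.carrier ((hitExtend hj c f).1 ∘ FI.fn (FI.optMap i)) := by
      rw [hcomp]
      exact (hitExtend hj d ⟨_, h⟩).2
    rw [mapsPresheaf_res_pos (admissible_hits _ _) i _ h,
      mapsPresheaf_res_pos (admissible_hits _ _) _ _ h1, Option.map_some]
    exact congrArg some (Subtype.ext hcomp)
  · have h1 : ¬ Hits P R d.opt.carrier ((hitExtend hj c f).1 ∘ FI.fn (FI.optMap i)) := by
      rw [hcomp]
      intro H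
      refine h ⟨fun a ha => ?_, fun x => H.2 (some x)⟩
      obtain ⟨x, hx⟩ := H.1 a (Finset.mem_of_mem_erase ha)
      cases x with
      | none => exact absurd hx.symm (Finset.ne_of_mem_erase ha)
      | some x => exact ⟨x, hx⟩
    rw [mapsPresheaf_res_neg (admissible_hits _ _) i _ h,
      mapsPresheaf_res_neg (admissible_hits _ _) _ _ h1, Option.map_none]

lemma hitExtend_res_inc {P R : Finset ℕ} {j : ℕ} (hj : j ∈ R) {c : FI}
    (f : (hitPresheaf (P.erase j) R).obj c) :
    (hitPresheaf P R).res c.inc (hitExtend hj c f) = hitFun P R c f := rfl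

/-- The linear extension of `hitExtend`. -/
def hitExt (k : Type u) [CommRing k] (P : Finset ℕ) {R : Finset ℕ} {j : ℕ} (hj : j ∈ R) (c : FI) :
    (hitMod k (P.erase j) R).obj (op c) →ₗ[k] (hitMod k P R).obj (op c.opt) :=
  pmap k fun f => some (hitExtend hj c f)

/-- The linear extension of `hitSplit`. -/
def hitComponent (k : Type u) [CommRing k] (P R : Finset ℕ) (j : ℕ) (c : FI) :
    (hitMod k P R).obj (op c.opt) →ₗ[k] (hitMod k (P.erase j) R).obj (op c) :=
  pmap k (hitSplit j c)

lemma hitComponent_hitExt_self (P : Finset ℕ) {R : Finset ℕ} {j : ℕ} (hj : j ∈ R) (c : FI)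
    (v : (hitMod k (P.erase j) R).obj (op c)) :
    hitComponent k P R j c (hitExt k P hj c v) = v := by
  refine LinearMap.congr_fun (f := (hitComponent k P R j c).comp (hitExt k P hj c))
    (g := LinearMap.id) (linearMap_ext fun f => ?_) v
  refine (congrArg (pmap k (hitSplit j c)) (pmap_single _ f)).trans ?_
  rw [pmap_gen, Option.bind_some, hitSplit_hitExtend_self]
  rfl

lemma hitComponent_hitExt_of_ne (P : Finset ℕ) {R : Finset ℕ} {j j' : ℕ} (hj : j ∈ R)
    (h : j ≠ j') (c : FI) (v : (hitMod k (P.erase j) R).obj (op c)) :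
    hitComponent k P R j' c (hitExt k P hj c v) = 0 := by
  refine LinearMap.congr_fun (f := (hitComponent k P R j' c).comp (hitExt k P hj c))
    (g := 0) (linearMap_ext fun f => ?_) v
  refine (congrArg (pmap k (hitSplit j' c)) (pmap_single _ f)).trans ?_
  rw [pmap_gen, Option.bind_some, hitSplit_hitExtend_of_ne hj h]
  rfl

lemma hitExt_basisElt (P : Finset ℕ) {R : Finset ℕ} {j : ℕ} (hj : j ∈ R) (c : FI)
    (f : (hitPresheaf (P.erase j) R).obj c) :
    hitExt k P hj c (basisElt k f) = basisElt k (hitExtend hj c f) := pmap_single _ f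

/-- The maps on `c ⊔ {*}` are partitioned by their value at the added point. -/
lemma sum_hitExt_hitComponent (P R : Finset ℕ) (c : FI) (v : (hitMod k P R).obj (op c.opt)) :
    ∑ j : R, hitExt k P j.2 c (hitComponent k P R j c v) = v := by
  have H : ∑ j : R, (hitExt k P j.2 c).comp (hitComponent k P R j c) = LinearMap.id := by
    refine freeMod_linearMap_ext fun f => ?_
    obtain ⟨j, hj, g, rfl⟩ := exists_hitExtend c f
    rw [LinearMap.sum_apply, Finset.sum_eq_single ⟨j, hj⟩]
    · rw [LinearMap.comp_apply, ← hitExt_basisElt, hitComponent_hitExt_self, LinearMap.id_apply]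
    · intro j' _ hj'
      rw [LinearMap.comp_apply, ← hitExt_basisElt, hitComponent_hitExt_of_ne P hj, map_zero]
      exact fun h => hj' (Subtype.ext h.symm)
    · simp
  have := LinearMap.congr_fun H v
  rwa [LinearMap.sum_apply] at this

lemma hitComponent_sum_hitExt (P R : Finset ℕ) (c : FI)
    (w : ∀ j : R, (hitMod k (P.erase j) R).obj (op c)) (j : R) :
    hitComponent k P R j c (∑ j' : R, hitExt k P j'.2 c (w j')) = w j := by
  rw [map_sum, Finset.sum_eq_single j, hitComponent_hitExt_self]
  · intro j' _ hj'
    exact hitComponent_hitExt_of_ne P j'.2 (fun h => hj' (Subtype.ext h)) c _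
  · simp

lemma res_optMap_hitExt (P : Finset ℕ) {R : Finset ℕ} {j : ℕ} (hj : j ∈ R) {c d : FI} (i : d ⟶ c)
    (w : (hitMod k (P.erase j) R).obj (op c)) :
    res (hitMod k P R) (FI.optMap i) (hitExt k P hj c w) =
      hitExt k P hj d (res (hitMod k (P.erase j) R) i w) := by
  refine LinearMap.congr_fun (f := (res (hitMod k P R) (FI.optMap i)).comp (hitExt k P hj c))
    (g := (hitExt k P hj d).comp (res (hitMod k (P.erase j) R) i))
    (freeMod_linearMap_ext fun f => ?_) w
  rw [LinearMap.comp_apply, LinearMap.comp_apply, hitExt_basisElt, freeMod_res_basisElt,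
    freeMod_res_basisElt, hitExtend_natural]
  cases (hitPresheaf (P.erase j) R).res i f with
  | none => exact (map_zero _).symm
  | some g => exact (hitExt_basisElt P hj d g).symm

lemma res_inc_hitExt (P : Finset ℕ) {R : Finset ℕ} {j : ℕ} (hj : j ∈ R) (c : FI)
    (w : (hitMod k (P.erase j) R).obj (op c)) :
    res (hitMod k P R) c.inc (hitExt k P hj c w) =
      comp (hitMap k (Finset.erase_subset j P) (Finset.Subset.refl R)) c w := by
  refine LinearMap.congr_fun (f := (res (hitMod k P R) c.inc).comp (hitExt k P hj c))
    (g := comp (hitMap k (Finset.erase_subset j P) (Finset.Subset.refl R)) c)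
    (freeMod_linearMap_ext fun f => ?_) w
  rw [LinearMap.comp_apply, hitExt_basisElt, freeMod_res_basisElt, hitExtend_res_inc]
  refine Eq.trans ?_ (pmap_single (k := k) (hitFun P R c) f).symm
  cases hitFun P R c f <;> rfl

lemma hitComponent_res_optMap (P : Finset ℕ) {R : Finset ℕ} {j : ℕ} (hj : j ∈ R) {c d : FI}
    (i : d ⟶ c) (v : (hitMod k P R).obj (op c.opt)) :
    hitComponent k P R j d (res (hitMod k P R) (FI.optMap i) v) =
      res (hitMod k (P.erase j) R) i (hitComponent k P R j c v) := by
  rw [← sum_hitExt_hitComponent P R c v, map_sum,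
    Finset.sum_congr rfl fun j' _ => res_optMap_hitExt P j'.2 i _,
    hitComponent_sum_hitExt P R d (fun j' => res (hitMod k (P.erase j') R) i
      (hitComponent k P R j' c v)) ⟨j, hj⟩,
    hitComponent_sum_hitExt P R c (fun j' => hitComponent k P R j' c v) ⟨j, hj⟩]

/-- Giving the added point a value `j ∈ R` and then restricting to `c` is a surjective map `hitMap`.
For `R = P = ∅` and nonzero `k` the statement fails, at the inclusion of the empty set into a point.
-/
lemma incSurjective_hitMod (P : Finset ℕ) {R : Finset ℕ} (hR : R.Nonempty) :
    IncSurjective (hitMod k P R) := by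
  obtain ⟨j, hj⟩ := hR
  intro c v
  obtain ⟨w, rfl⟩ := hitMap_surjective (k := k) (R := R) (Finset.erase_subset j P) c v
  exact ⟨hitExt k P hj c w, res_inc_hitExt P hj c w⟩

/-- The projection of the difference module to the part with value `j` at the added point. -/
def hitDiffProj (k : Type u) [CommRing k] (P : Finset ℕ) {R : Finset ℕ} {j : ℕ} (hj : j ∈ R) :
    diff (hitMod k P R) ⟶ hitMod k (P.erase j) R :=
  mkHom (fun c => (hitComponent k P R j c).comp diffVal)
    fun i x => hitComponent_res_optMap P hj i (diffVal x)

/-- The projection of the difference module to the parts with value different from `q` at the added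
point. -/
def hitDiffLift (k : Type u) [CommRing k] (P R : Finset ℕ) (q : ℕ) :
    diff (hitMod k P R) ⟶ piMod fun j : R.erase q => hitMod k (P.erase j) R :=
  piModLift fun j => hitDiffProj k P (Finset.mem_of_mem_erase j.2)

lemma hitDiffLift_proj (P R : Finset ℕ) (q : ℕ) (c : FI) (x : (diff (hitMod k P R)).obj (op c))
    (j : R.erase q) : comp (piModProj _ j) c (comp (hitDiffLift k P R q) c x) =
      hitComponent k P R j c (diffVal x) := rfl

/-- The components away from `q` can be prescribed freely; the component at `q` is then chosen so
that the restriction to `c` cancels. -/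
lemma hitDiffLift_surjective (P : Finset ℕ) {R : Finset ℕ} {q : ℕ} (hq : q ∈ R) (c : FI) :
    Function.Surjective (comp (hitDiffLift k P R q) c) := by
  classical
  intro y
  let w' : ∀ j : R, j.1 ≠ q → (hitMod k (P.erase j) R).obj (op c) := fun j hj =>
    comp (piModProj (fun j : R.erase q => hitMod k (P.erase j) R)
      ⟨j.1, Finset.mem_erase_of_ne_of_mem hj j.2⟩) c y
  -- `u` is the component at `q`: its image in `hit(P, R)` is minus the total restriction of the
  -- other components.
  obtain ⟨u, hu⟩ := hitMap_surjective (k := k) (R := R) (Finset.erase_subset q P) c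
    (-∑ j : R, if hj : j.1 ≠ q then
      comp (hitMap k (Finset.erase_subset j.1 P) (Finset.Subset.refl R)) c (w' j hj) else 0)
  let w : ∀ j : R, (hitMod k (P.erase j) R).obj (op c) := fun j =>
    if hj : j.1 ≠ q then w' j hj else (not_not.1 hj) ▸ u
  have hwq : w ⟨q, hq⟩ = u := dif_neg (not_not.2 rfl)
  refine ⟨diffMk (∑ j : R, hitExt k P j.2 c (w j)) ?_, piMod_ext fun j => ?_⟩
  · rw [map_sum, Finset.sum_congr rfl fun j _ => res_inc_hitExt P j.2 c (w j),
      ← Finset.add_sum_erase _ _ (Finset.mem_univ (⟨q, hq⟩ : R)), hwq, hu, neg_add_eq_zero,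
      ← Finset.add_sum_erase _ _ (Finset.mem_univ (⟨q, hq⟩ : R)), dif_neg (not_not.2 rfl), zero_add]
    refine Finset.sum_congr rfl fun j hj => ?_
    have hj' : j.1 ≠ q := fun h => Finset.ne_of_mem_erase hj (Subtype.ext h)
    rw [dif_pos hj']
    simp only [w, dif_pos hj']
  · rw [hitDiffLift_proj, diffVal_diffMk]
    refine (hitComponent_sum_hitExt P R c w ⟨j.1, Finset.mem_of_mem_erase j.2⟩).trans ?_
    exact dif_pos (Finset.ne_of_mem_erase j.2)

lemma eq_hitExt_of_hitDiffLift_eq_zero (P : Finset ℕ) {R : Finset ℕ} {q : ℕ} (hq : q ∈ R) (c : FI)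
    (x : (diff (hitMod k P R)).obj (op c)) (hx : comp (hitDiffLift k P R q) c x = 0) :
    diffVal x = hitExt k P hq c (hitComponent k P R q c (diffVal x)) ∧
      comp (hitMap k (Finset.erase_subset q P) (Finset.Subset.refl R)) c
        (hitComponent k P R q c (diffVal x)) = 0 := by
  have h : diffVal x = hitExt k P hq c (hitComponent k P R q c (diffVal x)) := by
    refine (sum_hitExt_hitComponent P R c (diffVal x)).symm.trans ?_
    refine Finset.sum_eq_single (⟨q, hq⟩ : R) (fun j _ hj => ?_) (by simp)
    have hj' : j.1 ≠ q := fun h => hj (Subtype.ext h)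
    have h1 := hitDiffLift_proj P R q c x ⟨j.1, Finset.mem_erase_of_ne_of_mem hj' j.2⟩
    rw [hx, map_zero] at h1
    rw [← h1, map_zero]
  refine ⟨h, ?_⟩
  rw [← res_inc_hitExt P hq, ← h, res_inc_diffVal]

/-- For `q ∉ P`, erasing `q` changes nothing, so restricting the `q` component to `c` loses no
information, and that component is determined by the others. -/
lemma nonempty_diff_hitMod_iso {P R : Finset ℕ} {q : ℕ} (hqR : q ∈ R) (hqP : q ∉ P) :
    Nonempty (diff (hitMod k P R) ≅ piMod fun j : R.erase q => hitMod k (P.erase j) R) := by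
  have : Epi (hitDiffLift k P R q) := (epi_iff _).2 (hitDiffLift_surjective P hqR)
  have : Mono (hitDiffLift k P R q) := by
    rw [mono_iff]
    intro c
    rw [← LinearMap.ker_eq_bot, LinearMap.ker_eq_bot']
    intro x hx
    obtain ⟨h1, h2⟩ := eq_hitExt_of_hitDiffLift_eq_zero P hqR c x hx
    have h3 := hitMap_injective (k := k) (Finset.erase_subset q P) (Finset.Subset.refl R)
      (Finset.erase_eq_of_notMem hqP).ge c
    refine diffVal_injective _ _ ?_
    rw [h1, h3 (h2.trans (map_zero _).symm), map_zero, map_zero]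
  have := isIso_of_mono_of_epi (hitDiffLift k P R q)
  exact ⟨asIso (hitDiffLift k P R q)⟩

lemma hitMap_erase_eq_zero {P R : Finset ℕ} {q : ℕ} (hqP : q ∈ P) (c : FI)
    (w : (hitMod k (P.erase q) (R.erase q)).obj (op c)) :
    comp (hitMap k (Finset.erase_subset q P) (Finset.Subset.refl R)) c
      (comp (hitMap k (Finset.Subset.refl (P.erase q)) (Finset.erase_subset q R)) c w) = 0 :=
  congrArg (fun φ => comp φ c w) (hitMap_hitMap_eq_zero (k := k) (Finset.erase_subset q P)
    (Finset.erase_subset q R) hqP (Finset.notMem_erase q R))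

/-- The inclusion into the difference module of the part with value `q` at the added point and
other values different from `q`. -/
def hitDiffIncl (k : Type u) [CommRing k] {P R : Finset ℕ} {q : ℕ} (hqR : q ∈ R) (hqP : q ∈ P) :
    hitMod k (P.erase q) (R.erase q) ⟶ diff (hitMod k P R) :=
  mkHom (fun c => ((hitExt k P hqR c).comp (comp (hitMap k (Finset.Subset.refl (P.erase q))
      (Finset.erase_subset q R)) c)).codRestrict (diffSub (hitMod k P R) c) fun w => by
        rw [LinearMap.mem_ker, LinearMap.comp_apply, res_inc_hitExt, hitMap_erase_eq_zero hqP])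
    fun {c d} i w => diffVal_injective _ _ (by
      change hitExt k P hqR d (comp (hitMap k (Finset.Subset.refl (P.erase q))
        (Finset.erase_subset q R)) d (res _ i w)) = res (hitMod k P R) (FI.optMap i)
          (hitExt k P hqR c (comp (hitMap k (Finset.Subset.refl (P.erase q))
            (Finset.erase_subset q R)) c w))
      rw [res_optMap_hitExt, comp_res])

lemma diffVal_hitDiffIncl {P R : Finset ℕ} {q : ℕ} (hqR : q ∈ R) (hqP : q ∈ P) (c : FI)
    (w : (hitMod k (P.erase q) (R.erase q)).obj (op c)) :
    diffVal (comp (hitDiffIncl k hqR hqP) c w) = hitExt k P hqR c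
      (comp (hitMap k (Finset.Subset.refl (P.erase q)) (Finset.erase_subset q R)) c w) := rfl

/-- The short complex which describes the difference module of a module of maps. -/
abbrev hitDiffShortComplex (k : Type u) [CommRing k] {P R : Finset ℕ} {q : ℕ} (hqR : q ∈ R)
    (hqP : q ∈ P) : ShortComplex (FIopMod k) :=
  ShortComplex.mk (hitDiffIncl k hqR hqP) (hitDiffLift k P R q)
    (FIop.hom_ext fun c w => piMod_ext fun j => by
      change hitComponent k P R j c (diffVal (comp (hitDiffIncl k hqR hqP) c w)) = 0
      rw [diffVal_hitDiffIncl,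
        hitComponent_hitExt_of_ne P hqR (Finset.ne_of_mem_erase j.2).symm])

/-- An element of the kernel has only a `q` component, which must die in `hit(P, R)`; it is
therefore supported on maps of `c` that avoid the value `q`. -/
lemma hitDiffShortComplex_shortExact {P R : Finset ℕ} {q : ℕ} (hqR : q ∈ R) (hqP : q ∈ P) :
    (hitDiffShortComplex k hqR hqP).ShortExact := by
  refine shortExact_of_app (fun c w w' h => ?_) (hitDiffLift_surjective P hqR) (fun c x hx => ?_)
  · have h1 := congrArg (fun t => hitComponent k P R q c (diffVal t)) h
    simp only [diffVal_hitDiffIncl, hitComponent_hitExt_self] at h1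
    exact hitMap_injective _ (Finset.erase_subset q R) (Finset.Subset.refl _) c h1
  · obtain ⟨h1, h2⟩ := eq_hitExt_of_hitDiffLift_eq_zero P hqR c x hx
    obtain ⟨w, hw⟩ := hitMap_exact (j := q) _ (Finset.erase_subset q R)
      (Finset.insert_erase hqP).ge (Finset.insert_erase hqR).ge c _ h2
    refine ⟨w, diffVal_injective _ _ ?_⟩
    rw [diffVal_hitDiffIncl, hw, ← h1]

/-! ### Values at small sets -/

lemma subsingleton_hitMod_empty_obj (c : FI) [Nonempty c.carrier] :
    Subsingleton ((hitMod k ∅ ∅).obj (op c)) := by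
  have : IsEmpty ((hitPresheaf ∅ ∅).obj c) :=
    ⟨fun f => Finset.notMem_empty _ (f.2.2 (Classical.arbitrary c.carrier))⟩
  exact inferInstanceAs (Subsingleton ((hitPresheaf ∅ ∅).obj c →₀ k))

lemma subsingleton_hitMod_obj_of_isEmpty {P : Finset ℕ} (hP : P.Nonempty) (R : Finset ℕ) (c : FI)
    [IsEmpty c.carrier] : Subsingleton ((hitMod k P R).obj (op c)) := by
  obtain ⟨a, ha⟩ := hP
  have : IsEmpty ((hitPresheaf P R).obj c) :=
    ⟨fun f => (f.2.1 a ha).elim fun x _ => isEmptyElim x⟩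
  exact inferInstanceAs (Subsingleton ((hitPresheaf P R).obj c →₀ k))

/-- With no condition on the values, there is exactly one map from the empty set. -/
def hitModEmptyEquiv (k : Type u) [CommRing k] (R : Finset ℕ) (c : FI) [IsEmpty c.carrier] :
    (hitMod k ∅ R).obj (op c) ≃ₗ[k] k :=
  letI : Unique ((hitPresheaf ∅ R).obj c) :=
    { default := ⟨isEmptyElim, fun _ ha => absurd ha (Finset.notMem_empty _), isEmptyElim⟩
      uniq := fun _ => Subtype.ext (funext isEmptyElim) }
  Finsupp.uniqueLinearEquiv k k default


/-! ## Free modules of given rank -/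

/-- The module `M` is free of rank `r`. -/
def FreeOfRank (k : Type u) [CommRing k] (r : ℕ) (M : Type*) [AddCommGroup M] [Module k M] : Prop :=
  Nonempty (M ≃ₗ[k] (Fin r → k))

namespace FreeOfRank

variable {M N L : Type*} [AddCommGroup M] [Module k M] [AddCommGroup N] [Module k N]
  [AddCommGroup L] [Module k L] {r s : ℕ}

lemma of_equiv (h : FreeOfRank k r M) (e : N ≃ₗ[k] M) : FreeOfRank k r N :=
  h.map e.trans

lemma of_subsingleton [Subsingleton M] : FreeOfRank k 0 M := ⟨0⟩

lemma subsingleton (h : FreeOfRank k 0 M) : Subsingleton M :=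
  h.elim fun e => e.toEquiv.subsingleton

lemma one_iff : FreeOfRank k 1 M ↔ Nonempty (M ≃ₗ[k] k) :=
  ⟨fun h => h.map fun e => e.trans (LinearEquiv.funUnique (Fin 1) k k),
    fun h => h.map fun e => e.trans (LinearEquiv.funUnique (Fin 1) k k).symm⟩

lemma of_fintype {ι : Type*} [Fintype ι] (e : M ≃ₗ[k] (ι → k)) :
    FreeOfRank k (Fintype.card ι) M :=
  ⟨e.trans (LinearEquiv.funCongrLeft k k (Fintype.equivFin ι).symm)⟩

lemma pi {ι : Type*} [Fintype ι] {A : ι → Type*} [∀ j, AddCommGroup (A j)] [∀ j, Module k (A j)]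
    {t : ι → ℕ} (h : ∀ j, FreeOfRank k (t j) (A j)) : FreeOfRank k (∑ j, t j) (∀ j, A j) := by
  have h' := of_fintype ((LinearEquiv.piCongrRight fun j => (h j).some).trans
    (LinearEquiv.piCurry k fun (j : ι) (_ : Fin (t j)) => k).symm)
  simpa using h'

lemma prod (hM : FreeOfRank k r M) (hN : FreeOfRank k s N) : FreeOfRank k (r + s) (M × N) := by
  have h := of_fintype ((hM.some.prodCongr hN.some).trans
    (LinearEquiv.sumArrowLequivProdArrow (Fin r) (Fin s) k k).symm)
  simpa using h

lemma of_exact {f : M →ₗ[k] N} {g : N →ₗ[k] L} (hf : Function.Injective f)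
    (hg : Function.Surjective g) (h : Function.Exact f g) (hM : FreeOfRank k r M)
    (hL : FreeOfRank k s L) : FreeOfRank k (r + s) N := by
  have : Module.Projective k L := Module.Projective.of_equiv hL.some.symm
  obtain ⟨l, hl⟩ := Module.projective_lifting_property g LinearMap.id hg
  exact (hM.prod hL).of_equiv (h.splitSurjectiveEquiv hf ⟨l, hl⟩).1

/-- A surjective endomorphism of a finitely generated module over a commutative ring is injective.
-/
lemma injective_of_surjective (hM : FreeOfRank k r M) (hN : FreeOfRank k r N) (f : M →ₗ[k] N)
    (hf : Function.Surjective f) : Function.Injective f := by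
  let e := hM.some
  let e' := hN.some
  have h : Function.Injective (e'.toLinearMap ∘ₗ f ∘ₗ e.symm.toLinearMap) :=
    OrzechProperty.injective_of_surjective_endomorphism _
      (e'.surjective.comp (hf.comp e.symm.surjective))
  intro x y hxy
  refine e.injective (h ?_)
  simp [hxy]

end FreeOfRank

/-! ## Ranks of the cohomology -/

/-- The rank of the degree zero cohomology at a set with `b` elements of the module of maps which
take `p` given values, and may take `q` other values. -/
def hitRank : ℕ → ℕ → ℕ → ℕ
  | 0, p, _ => if p = 0 then 1 else 0
  -- The factor `p` neutralises the truncated `p - 1`. The truncated `q - 1` is harmless because the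
  -- cohomology is only described for `q ≥ 1`.
  | b + 1, p, q => p * hitRank b (p - 1) (q + 1) + (q - 1) * hitRank b p q

/-- The rank of the degree zero cohomology at a set with `b` elements of the module of surjections
to a set with `a` elements. -/
def surjRank : ℕ → ℕ → ℕ
  | 0, 0 => 1
  | 0, _ + 1 => 0
  | _ + 1, 0 => 0
  | b + 1, a + 1 => surjRank b a + a * hitRank b a 1

/-- The object of `FI` obtained from the empty set by adding `b` points. -/
def FI.pt : ℕ → FI
  | 0 => ⟨Empty⟩
  | b + 1 => (FI.pt b).opt

instance : IsEmpty (FI.pt 0).carrier := inferInstanceAs (IsEmpty Empty)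

instance (b : ℕ) : Nonempty (FI.pt (b + 1)).carrier :=
  inferInstanceAs (Nonempty (Option (FI.pt b).carrier))

/-- The set `FI.pt b` has `b` elements. -/
def FI.ptEquiv : ∀ b : ℕ, (FI.pt b).carrier ≃ Fin b
  | 0 => Equiv.equivOfIsEmpty Empty (Fin 0)
  | b + 1 => (Equiv.optionCongr (FI.ptEquiv b)).trans (finSuccEquiv b).symm

/-- The indices `j ∈ R \ q` are of two kinds: erasing a `j ∈ P` turns a required value into an
optional one, and erasing any other `j` changes nothing. -/
lemma sum_card_erase {P R : Finset ℕ} {q : ℕ} (h : P ⊆ R) (hqR : q ∈ R) (hqP : q ∉ P)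
    (f : ℕ → ℕ → ℕ) : ∑ j : R.erase q, f (P.erase j).card (R \ P.erase j).card =
      P.card * f (P.card - 1) ((R \ P).card + 1) + ((R \ P).card - 1) * f P.card (R \ P).card := by
  have hu : R.erase q = P ∪ (R \ P).erase q := by
    ext x
    simp only [Finset.mem_erase, Finset.mem_union, Finset.mem_sdiff]
    by_cases hx : x ∈ P
    · simp only [hx, h hx, and_true, true_or, iff_true]
      rintro rfl
      exact hqP hx
    · simp [hx]
  have hd : Disjoint P ((R \ P).erase q) :=
    Finset.disjoint_left.2 fun x hx hx' =>
      (Finset.mem_sdiff.1 (Finset.mem_of_mem_erase hx')).2 hx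
  rw [Finset.sum_coe_sort (R.erase q) fun j => f (P.erase j).card (R \ P.erase j).card, hu,
    Finset.sum_union hd, Finset.sum_congr rfl (g := fun _ => f (P.card - 1) ((R \ P).card + 1)),
    Finset.sum_congr (s₁ := (R \ P).erase q) rfl (g := fun _ => f P.card (R \ P).card),
    Finset.sum_const, Finset.sum_const, smul_eq_mul, smul_eq_mul,
    Finset.card_erase_of_mem (Finset.mem_sdiff.2 ⟨hqR, hqP⟩)]
  · intro j hj
    rw [Finset.erase_eq_of_notMem (Finset.mem_sdiff.1 (Finset.mem_of_mem_erase hj)).2]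
  · intro j hj
    rw [Finset.card_erase_of_mem hj, Finset.sdiff_erase (h hj),
      Finset.card_insert_of_notMem fun hj' => (Finset.mem_sdiff.1 hj').2 hj]

/-- If some value need not be taken, the module of maps is acyclic. -/
theorem H_hitMod_of_ssubset (b : ℕ) {P R : Finset ℕ} (h : P ⊂ R) :
    (∀ n, Subsingleton (H (n + 1) (FI.pt b) (hitMod k P R))) ∧
      FreeOfRank k (hitRank b P.card (R \ P).card) (H 0 (FI.pt b) (hitMod k P R)) := by
  induction b generalizing P with
  | zero =>
    refine ⟨fun n => inferInstance, ?_⟩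
    refine FreeOfRank.of_equiv ?_ (hzeroEmptyEquiv (hitMod k P R) (FI.pt 0))
    rcases P.eq_empty_or_nonempty with rfl | hP
    · rw [Finset.card_empty]
      exact FreeOfRank.one_iff.2 ⟨hitModEmptyEquiv k R (FI.pt 0)⟩
    · rw [hitRank, if_neg hP.card_ne_zero]
      have := subsingleton_hitMod_obj_of_isEmpty (k := k) hP R (FI.pt 0)
      exact FreeOfRank.of_subsingleton
  | succ b ih =>
    obtain ⟨q, hqR, hqP⟩ := Finset.exists_of_ssubset h
    -- The optional value `q` remains optional in every factor, so the induction stays among proper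
    -- inclusions.
    have e : ∀ n, Nonempty (H n (FI.pt b).opt (hitMod k P R) ≃ₗ[k]
        ∀ j : R.erase q, H n (FI.pt b) (hitMod k (P.erase j) R)) := fun n => by
      obtain ⟨e₁⟩ := nonempty_H_opt_equiv n (FI.pt b) (hitMod k P R)
        (incSurjective_hitMod P ⟨q, hqR⟩)
      obtain ⟨e₂⟩ := nonempty_diff_hitMod_iso (k := k) hqR hqP
      exact ⟨e₁.trans ((hmapIso n (FI.pt b) e₂).trans (hpiEquiv _ n (FI.pt b)))⟩
    have ih' := fun j => ih (P := P.erase j)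
      ⟨(Finset.erase_subset j P).trans h.1, fun h' => hqP (Finset.mem_of_mem_erase (h' hqR))⟩
    constructor
    · intro n
      have := fun j : R.erase q => (ih' j).1 n
      exact (e (n + 1)).some.toEquiv.subsingleton
    · have := FreeOfRank.of_equiv (FreeOfRank.pi fun j : R.erase q => (ih' j).2) (e 0).some
      rwa [sum_card_erase h.1 hqR hqP (hitRank b)] at this

/-- The cohomology of the module concentrated at the empty set. -/
theorem H_hitMod_empty (n b : ℕ) :
    FreeOfRank k (if n = b then 1 else 0) (H n (FI.pt b) (hitMod k ∅ ∅)) := by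
  induction b generalizing n with
  | zero =>
    cases n with
    | zero => exact FreeOfRank.one_iff.2 ⟨(hzeroEmptyEquiv _ _).trans (hitModEmptyEquiv k ∅ _)⟩
    | succ n => exact FreeOfRank.of_subsingleton
  | succ b ih =>
    cases n with
    | zero =>
      have := subsingleton_hitMod_empty_obj (k := k) (FI.pt (b + 1))
      have := (hzeroEquiv (hitMod k ∅ ∅) (FI.pt (b + 1))).toEquiv.subsingleton
      exact FreeOfRank.of_subsingleton
    | succ n =>
      -- The difference functor cannot be applied to `hit(∅, ∅)` directly, since its restrictions
      -- are not surjective. The shift by one degree passes to surjections onto a point, whose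
      -- difference module is again `hit(∅, ∅)`.
      have hS := hitShortComplex_shortExact (k := k) ∅ (Finset.notMem_empty 0)
      have h2 := H_hitMod_of_ssubset (k := k) (b + 1) (P := ∅) (R := insert 0 ∅)
        (Finset.ssubset_insert (Finset.notMem_empty 0))
      -- Over a nonempty set even `H^0` of the middle term vanishes: the recursion gives rank `0`
      -- for no required and one optional value.
      have h2' : ∀ m, Subsingleton (H m (FI.pt (b + 1))
          (hitShortComplex k ∅ (Finset.notMem_empty 0)).X₂) := fun m => by
        cases m with
        | zero =>
          refine FreeOfRank.subsingleton (k := k) ?_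
          have := h2.2
          simpa [hitRank] using this
        | succ m => exact h2.1 m
      have := h2' n
      have := h2' (n + 1)
      let e₁ := hdeltaEquiv hS n (FI.pt (b + 1))
      obtain ⟨e₂⟩ := nonempty_H_opt_equiv n (FI.pt b) (hitMod k (insert 0 ∅) (insert 0 ∅))
        (incSurjective_hitMod _ (Finset.insert_nonempty _ _))
      have h0 : (0 : ℕ) ∈ insert 0 (∅ : Finset ℕ) := Finset.mem_insert_self _ _
      have hD := hitDiffShortComplex_shortExact (k := k) h0 h0
      -- The product is indexed by the empty set, so the inclusion of `hit(∅, ∅)` into the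
      -- difference module is an isomorphism on cohomology.
      have hX : ∀ m, Subsingleton (H m (FI.pt b) (hitDiffShortComplex k h0 h0).X₃) := fun m => by
        have : IsEmpty ((insert 0 (∅ : Finset ℕ)).erase 0) := ⟨fun j => by simpa using j.2⟩
        exact (hpiEquiv _ m (FI.pt b)).toEquiv.subsingleton
      let e₃ : H n (FI.pt b) (hitDiffShortComplex k h0 h0).X₁ ≃ₗ[k]
          H n (FI.pt b) (hitDiffShortComplex k h0 h0).X₂ :=
        LinearEquiv.ofBijective (hmap _ n (FI.pt b)) ⟨by
          cases n with
          | zero =>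
            have := hD.mono_f
            exact hmap_zero_injective _ _
          | succ n =>
            rw [← LinearMap.ker_eq_bot, LinearMap.ker_eq_bot']
            intro x hx
            obtain ⟨y, rfl⟩ := (exact_hdelta_hmap hD n (FI.pt b) x).1 hx
            rw [(hX n).elim y 0, map_zero],
          fun x => (exact_hmap_hmap hD n (FI.pt b) x).1 ((hX n).elim _ _)⟩
      have ih' := ih n
      rw [show (∅ : Finset ℕ) = (insert 0 (∅ : Finset ℕ)).erase 0 from rfl] at ih'
      have := ((ih'.of_equiv e₃.symm).of_equiv e₂).of_equiv e₁.symm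
      simpa using this

/-- The cohomology in positive degrees of the module of surjections. -/
theorem H_hitMod_self_succ (n b : ℕ) (P : Finset ℕ) :
    FreeOfRank k (if n + 1 + P.card = b then 1 else 0)
      (H (n + 1) (FI.pt b) (hitMod k P P)) := by
  induction P using Finset.induction_on generalizing n with
  | empty => exact H_hitMod_empty (n + 1) b
  | insert j P hj ih =>
    have h2 := (H_hitMod_of_ssubset (k := k) b (Finset.ssubset_insert hj)).1
    have : Subsingleton (H (n + 1) (FI.pt b) (hitShortComplex k P hj).X₂) := h2 n
    -- With the middle term acyclic, one more required value lowers the degree by one: `H^(n+1)` for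
    -- `insert j P` is `H^(n+2)` for `P`.
    have : Subsingleton (H (n + 1 + 1) (FI.pt b) (hitShortComplex k P hj).X₂) := h2 (n + 1)
    have := (ih (n + 1)).of_equiv
      (hdeltaEquiv (hitShortComplex_shortExact (k := k) P hj) (n + 1) (FI.pt b))
    rw [Finset.card_insert_of_notMem hj]
    rwa [show n + 1 + 1 + P.card = n + 1 + (P.card + 1) by ring] at this

/-- The cohomology in degree zero of the module of surjections. -/
theorem H_zero_hitMod_self (b : ℕ) (P : Finset ℕ) :
    FreeOfRank k (surjRank b P.card) (H 0 (FI.pt b) (hitMod k P P)) := by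
  induction b generalizing P with
  | zero =>
    rcases P.eq_empty_or_nonempty with rfl | hP
    · exact H_hitMod_empty 0 0
    · have := subsingleton_hitMod_obj_of_isEmpty (k := k) hP P (FI.pt 0)
      have := (hzeroEmptyEquiv (hitMod k P P) (FI.pt 0)).toEquiv.subsingleton
      obtain ⟨a, ha⟩ := Nat.exists_eq_succ_of_ne_zero hP.card_ne_zero
      rw [ha]
      exact FreeOfRank.of_subsingleton
  | succ b ih =>
    rcases P.eq_empty_or_nonempty with rfl | ⟨q, hq⟩
    · exact H_hitMod_empty 0 (b + 1)
    have hcard := Finset.card_erase_add_one hq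
    have e := fun n => nonempty_H_opt_equiv n (FI.pt b) (hitMod k P P)
      (incSurjective_hitMod P ⟨q, hq⟩)
    have hD := hitDiffShortComplex_shortExact (k := k) hq hq
    have h3 := fun j : P.erase q => H_hitMod_of_ssubset (k := k) b
      (Finset.erase_ssubset (Finset.mem_of_mem_erase j.2))
    have h3' : Subsingleton (H 1 (FI.pt b) (hitDiffShortComplex k hq hq).X₃) := by
      have := fun j => (h3 j).1 0
      exact (hpiEquiv _ 1 (FI.pt b)).toEquiv.subsingleton
    have h3'' : FreeOfRank k ((P.erase q).card * hitRank b (P.erase q).card 1)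
        (H 0 (FI.pt b) (hitDiffShortComplex k hq hq).X₃) := by
      refine FreeOfRank.of_equiv ?_ (hpiEquiv _ 0 (FI.pt b))
      convert FreeOfRank.pi fun j => (h3 j).2
      rw [Finset.sum_congr rfl (g := fun _ => hitRank b (P.erase q).card 1), Finset.sum_const,
        Finset.card_univ, Fintype.card_coe, smul_eq_mul]
      intro j _
      have hj := Finset.mem_of_mem_erase j.2
      rw [Finset.sdiff_erase_self hj, Finset.card_singleton, Finset.card_erase_of_mem hj,
        Finset.card_erase_of_mem hq]
    have h1 := H_hitMod_self_succ (k := k) 0 b (P.erase q)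
    have h2 := (H_hitMod_self_succ (k := k) 0 (b + 1) P).of_equiv (e 1).some.symm
    -- The map is onto since `H^1` of the product vanishes, and source and target are free of the
    -- same rank: one if `|P| = b` and zero otherwise.
    have hi : Function.Injective (hmap (hitDiffShortComplex k hq hq).f 1 (FI.pt b)) := by
      refine FreeOfRank.injective_of_surjective h1 ?_ _ fun x =>
        (exact_hmap_hmap hD 1 (FI.pt b) x).1 (h3'.elim _ _)
      convert h2 using 2
      omega
    -- Injectivity on `H^1` forces the connecting map out of `H^0` to be zero.
    have hs : Function.Surjective (hmap (hitDiffShortComplex k hq hq).g 0 (FI.pt b)) := by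
      intro x
      refine (exact_hmap_hdelta hD 0 (FI.pt b) x).1 (hi ?_)
      rw [map_zero]
      exact (exact_hdelta_hmap hD 0 (FI.pt b) _).2 ⟨x, rfl⟩
    have := hD.mono_f
    have h := (FreeOfRank.of_exact (hmap_zero_injective (FI.pt b) (hitDiffShortComplex k hq hq).f)
      hs (exact_hmap_hmap hD 0 (FI.pt b)) (ih (P.erase q)) h3'').of_equiv (e 0).some
    rw [← hcard]
    exact h

end FIop

namespace FIop

/-! ## The recursion of the ranks -/

lemma hitRank_succ (b p q : ℕ) :
    hitRank (b + 1) p (q + 1) = p * hitRank b (p - 1) (q + 2) + q * hitRank b p (q + 1) := rfl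

/-- This is additivity of the rank of `H^0` along `hitShortComplex` when all three terms are
acyclic; here it is verified from the recursion. -/
lemma hitRank_add_two (b p q : ℕ) :
    hitRank b p (q + 2) = hitRank b p (q + 1) + hitRank b (p + 1) (q + 1) := by
  induction b generalizing p q with
  | zero => simp [hitRank]
  | succ b ih =>
    rw [hitRank_succ b p (q + 1), hitRank_succ b p q, hitRank_succ b (p + 1) q,
      Nat.add_sub_cancel]
    have h1 := ih p q
    cases p with
    | zero =>
      rw [h1]
      ring
    | succ p =>
      have h2 := ih p (q + 1)
      rw [Nat.add_sub_cancel, h2]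
      linear_combination q * h1

lemma surjRank_succ_succ (b a : ℕ) :
    surjRank (b + 1) (a + 1) = surjRank b a + a * hitRank b a 1 := rfl

/-- The analogue when no optional value is left in the outer terms. The correction is the rank of
`H^1` of surjections onto `p` values, where the long exact sequence continues. -/
lemma hitRank_one_add (b p : ℕ) :
    hitRank b p 1 + (if b = p + 1 then 1 else 0) = surjRank b p + surjRank b (p + 1) := by
  induction b generalizing p with
  | zero => cases p <;> simp [hitRank, surjRank]
  | succ b ih =>
    cases p with
    | zero => cases b <;> simp [hitRank, surjRank]
    | succ p =>
      have h := ih p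
      rw [hitRank_succ, hitRank_add_two, surjRank_succ_succ, surjRank_succ_succ,
        Nat.add_sub_cancel]
      simp only [Nat.add_right_cancel_iff] at h ⊢
      linear_combination h

/-- The general recursion of `Rk`, valid throughout once the correction at `b = a + 1` is included;
that correction is why `Rk(a + 1, a)` needs its own formula. It stands on the left to avoid
subtraction. -/
lemma surjRank_recursion (b a : ℕ) :
    surjRank (b + 1) (a + 1) + a * (if b = a + 1 then 1 else 0) =
      (a + 1) * surjRank b a + a * surjRank b (a + 1) := by
  rw [surjRank_succ_succ]
  linear_combination a * hitRank_one_add b a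

lemma surjRank_of_lt {b a : ℕ} (h : b < a) : surjRank b a = 0 := by
  induction b generalizing a with
  | zero =>
    obtain ⟨a, rfl⟩ := Nat.exists_eq_succ_of_ne_zero h.ne'
    rfl
  | succ b ih =>
    obtain ⟨a, rfl⟩ := Nat.exists_eq_succ_of_ne_zero (Nat.ne_zero_of_lt h)
    have h1 := surjRank_recursion b a
    rw [ih (Nat.lt_of_succ_lt_succ h), ih (by omega), if_neg (by omega)] at h1
    simpa using h1

lemma surjRank_self (a : ℕ) : surjRank a a = a.factorial := by
  induction a with
  | zero => rfl
  | succ a ih =>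
    have h1 := surjRank_recursion a a
    rw [ih, surjRank_of_lt (Nat.lt_succ_self a), if_neg (by omega)] at h1
    rw [Nat.factorial_succ]
    simpa using h1

/-- The formula for `Rk(a + 1, a)` with `a = m + 2`, doubled so that no division occurs in the
induction. -/
lemma two_mul_surjRank (m : ℕ) :
    2 * surjRank (m + 3) (m + 2) = m * (m + 3).factorial + 2 := by
  induction m with
  | zero => rfl
  | succ m ih =>
    have h1 := surjRank_recursion (m + 3) (m + 2)
    rw [if_pos rfl, surjRank_self, mul_one] at h1
    have h2 := Nat.factorial_succ (m + 3)
    refine Nat.add_right_cancel (m := 2 * (m + 2)) ?_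
    rw [h2]
    linear_combination 2 * h1 + (m + 3) * ih

lemma surjRank_eq_Rk (b a : ℕ) : surjRank b a = Rk b a := by
  induction b generalizing a with
  | zero => cases a <;> rfl
  | succ b ih =>
    cases a with
    | zero => rfl
    | succ a =>
      rw [Rk]
      split_ifs with h1 h2 h3 h4
      · exact surjRank_of_lt (Nat.succ_lt_succ h1)
      · rw [h2, surjRank_self]
      · subst h3
        obtain ⟨b, rfl⟩ := Nat.exists_eq_succ_of_ne_zero h2
        simp [surjRank]
      · obtain ⟨m, rfl⟩ := Nat.exists_eq_succ_of_ne_zero h3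
        have h5 := two_mul_surjRank m
        subst h4
        simp only [Nat.succ_eq_add_one, Nat.add_sub_cancel] at h5 ⊢
        change surjRank (m + 3) (m + 2) = m * (m + 3).factorial / 2 + 1
        omega
      · have h5 := surjRank_recursion b a
        rw [if_neg h4, ih, ih] at h5
        simpa using h5

end FIop

namespace FIop

/-! ## The module of surjections -/

/-- Surjections to `{0, …, a - 1}`, as maps with image `{0, …, a - 1}`. -/
def surjEquiv (a : ℕ) (c : FI) : ((⟨c.carrier⟩ : Omega) ⟶ (⟨Fin a⟩ : Omega)) ≃
    (hitPresheaf (Finset.range a) (Finset.range a)).obj c where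
  toFun f := ⟨fun x => (f.1 x : Fin a), fun y hy => by
    obtain ⟨x, hx⟩ := f.2 (⟨y, Finset.mem_range.1 hy⟩ : Fin a)
    exact ⟨x, congrArg Fin.val hx⟩, fun x => Finset.mem_range.2 (f.1 x : Fin a).2⟩
  invFun f := ⟨fun x => (⟨f.1 x, Finset.mem_range.1 (f.2.2 x)⟩ : Fin a), fun y => by
    obtain ⟨x, hx⟩ := f.2.1 (y : Fin a).1 (Finset.mem_range.2 (y : Fin a).2)
    exact ⟨x, Fin.ext hx⟩⟩
  left_inv _ := rfl
  right_inv _ := rfl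

variable {k : Type u} [CommRing k]

lemma surjEquiv_restrictSurj (a : ℕ) {c d : FI} (i : d ⟶ c)
    (f : (⟨c.carrier⟩ : Omega) ⟶ (⟨Fin a⟩ : Omega)) :
    Finsupp.domLCongr (R := k) (M := k) (surjEquiv a d) (restrictSurj k ⟨Fin a⟩ i f) =
      gen k ((hitPresheaf (Finset.range a) (Finset.range a)).res i (surjEquiv a c f)) := by
  by_cases h : Function.Surjective (f.1 ∘ FI.fn i)
  · have h' : Hits (Finset.range a) (Finset.range a) d.carrier
        ((surjEquiv a c f).1 ∘ FI.fn i) := (surjEquiv a d ⟨_, h⟩).2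
    rw [mapsPresheaf_res_pos (admissible_hits _ _) i _ h', gen_some]
    refine (congrArg _ (dif_pos h)).trans ?_
    rw [Finsupp.domLCongr_single]
    rfl
  · have h' : ¬ Hits (Finset.range a) (Finset.range a) d.carrier
        ((surjEquiv a c f).1 ∘ FI.fn i) := fun H => h ((surjEquiv a d).symm ⟨_, H⟩).2
    rw [mapsPresheaf_res_neg (admissible_hits _ _) i _ h', gen_none]
    exact (congrArg _ (dif_neg h)).trans (map_zero _)

/-- The module of surjections is a module of maps with given image. -/
def kHomIso (k : Type u) [CommRing k] (a : ℕ) :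
    kHom k ⟨Fin a⟩ ≅ hitMod k (Finset.range a) (Finset.range a) :=
  NatIso.ofComponents
    (fun c => (Finsupp.domLCongr (R := k) (M := k) (surjEquiv a c.unop)).toModuleIso)
    fun {c d} i => by
      ext1
      refine linearMap_ext fun f => ?_
      change Finsupp.domLCongr (R := k) (M := k) (surjEquiv a d.unop)
        (Finsupp.linearCombination k (restrictSurj k ⟨Fin a⟩ i.unop) (Finsupp.single f 1)) =
          pmap k ((hitPresheaf (Finset.range a) (Finset.range a)).res i.unop)
            (Finsupp.domLCongr (R := k) (M := k) (surjEquiv a c.unop) (Finsupp.single f 1))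
      rw [Finsupp.linearCombination_single, one_smul, surjEquiv_restrictSurj,
        Finsupp.domLCongr_single, pmap_single]

/-- The cohomology of the module of surjections, at a standard finite set. -/
def cohomologyKHomEquiv (k : Type u) [CommRing k] (a b n : ℕ) :
    ((cohomology k n).obj (kHom k ⟨Fin a⟩)).obj (op ⟨Fin b⟩) ≃ₗ[k]
      H n (FI.pt b) (hitMod k (Finset.range a) (Finset.range a)) :=
  let e : (⟨(FI.pt b).carrier⟩ : FB) ≅ ⟨Fin b⟩ :=
    { hom := FB.ofEquiv (FI.ptEquiv b)
      inv := FB.ofEquiv (FI.ptEquiv b).symm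
      hom_inv_id := (FI.ptEquiv b).self_trans_symm
      inv_hom_id := (FI.ptEquiv b).symm_trans_self }
  ((((cohomology k n).mapIso (kHomIso k a)).app (op ⟨Fin b⟩)) ≪≫
    ((cohomology k n).obj _).mapIso e.op).toLinearEquiv.trans (cohomologyEquiv _ n (FI.pt b))

lemma freeOfRank_cohomology_kHom_zero (a b : ℕ) : FreeOfRank k (Rk b a)
    (((cohomology k 0).obj (kHom k ⟨Fin a⟩)).obj (op ⟨Fin b⟩)) := by
  have h := H_zero_hitMod_self (k := k) b (Finset.range a)
  rw [Finset.card_range, surjRank_eq_Rk] at h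
  exact h.of_equiv (cohomologyKHomEquiv k a b 0)

lemma freeOfRank_cohomology_kHom_succ (a b n : ℕ) :
    FreeOfRank k (if n + 1 + a = b then 1 else 0)
      (((cohomology k (n + 1)).obj (kHom k ⟨Fin a⟩)).obj (op ⟨Fin b⟩)) := by
  have h := H_hitMod_self_succ (k := k) n b (Finset.range a)
  rw [Finset.card_range] at h
  exact h.of_equiv (cohomologyKHomEquiv k a b (n + 1))

end FIop

end

/-! ### Assembly of the cases -/

theorem mainTheorem4 (k : Type u) [CommRing k] (a b n : ℕ) :
    (a ≤ b → 0 < a → n = 0 →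
      Nonempty (((FIop.cohomology k n).obj (FIop.kHom k ⟨Fin a⟩)).obj (op ⟨Fin b⟩) ≃ₗ[k]
        (Fin (FIop.Rk b a) → k))) ∧
    ((a < b ∧ n = b - a) ∨ (a = 0 ∧ b = 0 ∧ n = 0) →
      Nonempty (((FIop.cohomology k n).obj (FIop.kHom k ⟨Fin a⟩)).obj (op ⟨Fin b⟩) ≃ₗ[k] k)) ∧
    (¬ (a ≤ b ∧ 0 < a ∧ n = 0) →
      ¬ ((a < b ∧ n = b - a) ∨ (a = 0 ∧ b = 0 ∧ n = 0)) →
      Subsingleton (((FIop.cohomology k n).obj (FIop.kHom k ⟨Fin a⟩)).obj (op ⟨Fin b⟩))) := by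
  cases n with
  | zero =>
    have h := FIop.freeOfRank_cohomology_kHom_zero (k := k) a b
    refine ⟨fun _ _ _ => h, fun h' => ?_, fun h₁ h₂ => ?_⟩
    · obtain ⟨rfl, rfl, -⟩ : a = 0 ∧ b = 0 ∧ 0 = 0 := h'.resolve_left (by omega)
      exact FIop.FreeOfRank.one_iff.1 h
    · have h0 : FIop.Rk b a = 0 := by
        rw [← FIop.surjRank_eq_Rk]
        rcases lt_or_ge b a with hba | hab
        · exact FIop.surjRank_of_lt hba
        -- With `a ≤ b` in degree zero, the excluded cases leave only `a = 0 < b`, where the rank is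
        -- zero.
        · obtain ⟨b, rfl⟩ := Nat.exists_eq_succ_of_ne_zero (show b ≠ 0 by omega)
          obtain rfl : a = 0 := by omega
          rfl
      rw [h0] at h
      exact h.subsingleton
  | succ n =>
    have h := FIop.freeOfRank_cohomology_kHom_succ (k := k) a b n
    refine ⟨fun _ _ h' => absurd h' (Nat.succ_ne_zero n), fun h' => ?_, fun _ h₂ => ?_⟩
    · rw [if_pos (by omega)] at h
      exact FIop.FreeOfRank.one_iff.1 h
    · rw [if_neg (by omega)] at h
      exact h.subsingleton
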